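/- Let $M=\{z=x+iy:\ |z|\le 1\}$ be the closed unit disc, $SM=M\times\mathbb S^1$ with angular variable $\theta$, and $X=\cos\theta\,\partial_x+\sin\theta\,\partial_y$. Parametrize $\partial SM$ by fan-beam coordinates $(\beta,\alpha)\in(\mathbb R/2\pi\mathbb Z)^2$: base point $e^{i\beta}$, direction $\theta=\beta+\pi+\alpha$; $\partial_+SM$ is the part $-\pi/2\le\alpha\le\pi/2$, $\partial_-SM$ the part $\pi/2\le\alpha\le3\pi/2$, and $L^2(\partial SM)$, $L^2(\partial_+SM)$ are taken with respect to $d\beta\,d\alpha$. Let $\mathcal S(\beta,\alpha)=(\beta+\pi+2\alpha,\pi-\alpha)$, $\mathcal S_A(\beta,\alpha)=(\beta+\pi+2\alpha,-\alpha)$ and $\mathcal V_-=\{h\in L^2(\partial_+SM):\ h\circ\mathcal S_A=-h\}$. For $u$ on $\partial_+SM$ let $A_\pm u=u$ on $\partial_+SM$ and $A_\pm u=\pm u\circ\mathcal S$ on $\partial_-SM$; for $u$ on $\partial SM$ let $A_\pm^*u=(u\pm u\circ\mathcal S)|_{\partial_+SM}$. Let $H$ be the fiberwise Hilbert transform on $L^2(SM)$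 or $L^2(\partial SM)$, i.e. the bounded operator with $H(f(\mathrm x)e^{ik\theta})=-i\,\mathrm{sgn}(k)f(\mathrm x)e^{ik\theta}$ for $k\in\mathbb Z$ ($\mathrm{sgn}(0)=0$), and let $H_-$ be its restriction to odd $k$ (and $0$ on even $k$). Put $P_-^*=-A_+^*H_-A_-$. For $h$ on $\partial_+SM$ let $h_\psi$ be the function on $SM$ that is constant along the geodesics $t\mapsto(\mathrm x+te^{i\theta},\theta)$ and equals $h$ on $\partial_+SM$. For $a\in C^0(M,\mathbb C)$ let $I_0a(\beta,\alpha)=\int_0^{2\cos\alpha}a\big(e^{i\beta}+te^{i(\beta+\pi+\alpha)}\big)\,dt$ on $\partial_+SM$. **Proposition.** Let $a\in C^0(M,\mathbb C)$, and define $$n=-\frac1{8\pi}P_-^*I_0a,\qquad w_a=2\pi i\,(Id+iH)\,n_\psi .$$ Then $n\in\mathcal V_-$, $n_\psi$ and $w_a$ belong to $L^2(SM)$, and $w_a$ is fiberwise odd ($w_a(\mathrm x,\theta+\pi)=-w_a(\mathrm x,\theta)$ a.e.), fiberwise holomorphic (for every integer $k<0$ the angular Fourier coefficient $\int_0^{2\pi}w_a(\mathrm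 x,\theta)e^{-ik\theta}\,d\theta$ vanishes for a.e. $\mathrm x\in M$), and solves $Xw_a=-a$ in the sense of distributions on the interior of $SM$. Its boundary values are $$\rho_a:=w_a|_{\partial_+SM}=\frac12I_0a-\frac i4P_-^*I_0a,\qquad w_a|_{\partial SM}=\frac12A_-I_0a-\frac i4A_+P_-^*I_0a ,$$ in the sense of traces along geodesics: on almost every geodesic, $w_a$ agrees a.e. with a function that is continuous up to both end points of the geodesic, and takes the stated values there. -/

import Mathlib

open MeasureTheory Set Real
open scoped ContDiff

namespace DiscTransport

noncomputable section

/-! ### Phase space of the unit disc -/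

/-- The circle `ℝ / 2πℤ`; its `volume` is `dθ`, of total mass `2π`. -/
abbrev Circ : Type := AddCircle (2 * π)

instance factTwoPiPos : Fact (0 < 2 * π) := ⟨Real.two_pi_pos⟩

/-- The unit vector `e^{iθ}`, as a complex number. -/
def dir (θ : Circ) : ℂ := fourier 1 θ

/-- `cos θ` for `θ` in the circle. -/
def ccos (θ : Circ) : ℝ := (dir θ).re

/-- The angle `π`, as a point of the circle. -/
def piC : Circ := ((π : ℝ) : Circ)

/-- The closed unit disc `M`; a point `(x, y)` is the complex number `x + iy`. -/
def disc : Set ℂ := Metric.closedBall 0 1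

/-- The measure `dx dθ` of `SM = M × S¹`. A function on `SM` is a function on `ℂ × Circ`
whose values outside of `disc` play no role. -/
def measSM : Measure (ℂ × Circ) := (volume.restrict disc).prod volume

/-- The measure `dβ dα` of `∂SM` in fan-beam coordinates `(β, α)`: the base point is `e^{iβ}` and
the direction has the angle `θ = β + π + α`. -/
def measBdry : Measure (Circ × Circ) := (volume : Measure Circ).prod (volume : Measure Circ)

/-- The inward boundary `∂₊SM`, that is `-π/2 ≤ α ≤ π/2`. -/
def inflow : Set (Circ × Circ) := {p | 0 ≤ ccos p.2}

/-- The measure `dβ dα` of `∂₊SM`. -/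
def measInflow : Measure (Circ × Circ) := measBdry.restrict inflow

/-- The scattering relation. -/
def scat (p : Circ × Circ) : Circ × Circ := (p.1 + piC + 2 • p.2, piC - p.2)

/-- The antipodal scattering relation. -/
def scatA (p : Circ × Circ) : Circ × Circ := (p.1 + piC + 2 • p.2, -p.2)

/-- The geodesic flow `φ_t` issued from the boundary point with fan-beam coordinates `p`.
For `p` in `∂₊SM` it stays in `SM` exactly for the times `0 ≤ t ≤ 2 cos α`, and it ends at
the boundary point `scat p`. -/
def flow (p : Circ × Circ) (t : ℝ) : ℂ × Circ :=
  (dir p.1 + t * dir (p.1 + piC + p.2), p.1 + piC + p.2)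

/-! ### Fiberwise harmonics and the fiberwise Hilbert transform

Everything is done on `Y × Circ` for a measure `ν` on the base `Y`, and used both for `SM` (with
fiber coordinate `θ`) and for `∂SM` (base coordinate `β`, fiber coordinate `α`). In the latter case
`e^{ikθ} = e^{ik(β+π)} e^{ikα}`, so that the functions of the form `f(β) e^{ikθ}` are those of the
form `f(β) e^{ikα}`. -/

section Fiber

variable {Y : Type*} [MeasurableSpace Y] (ν : Measure Y)

/-- `L²(Y × S¹)`. -/
abbrev L2 : Type _ := Lp ℂ 2 (ν.prod (volume : Measure Circ))

/-- The closed span of the `f(y) e^{ikθ}` in `L²` with `k ∈ K`. -/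
def harmonicSpace (K : Set ℤ) : Submodule ℂ (L2 ν) :=
  (Submodule.span ℂ {u : L2 ν | ∃ k ∈ K, ∃ f : Y → ℂ,
    u =ᵐ[ν.prod volume] fun p => f p.1 * fourier k p.2}).topologicalClosure

instance harmonicSpace_complete (K : Set ℤ) : CompleteSpace (harmonicSpace ν K) :=
  (Submodule.isClosed_topologicalClosure _).completeSpace_coe

/-- The orthogonal projection onto the harmonics with index in `K`. -/
def harmonicProj (K : Set ℤ) : L2 ν →L[ℂ] L2 ν := (harmonicSpace ν K).starProjection

/-- The Hilbert transform restricted to the harmonics with index in `K`: it multiplies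
`f(y) e^{ikθ}` by `-i sgn k` for `k ∈ K`, and by `0` for `k ∉ K`. -/
def hilbertLp (K : Set ℤ) : L2 ν →L[ℂ] L2 ν :=
  (-Complex.I) • (harmonicProj ν (K ∩ {k | 0 < k}) - harmonicProj ν (K ∩ {k | k < 0}))

open Classical in
/-- `hilbertLp` acting on square integrable functions instead of their classes (the value is
defined almost everywhere). -/
def hilbertOn (K : Set ℤ) (u : Y × Circ → ℂ) : Y × Circ → ℂ :=
  if h : MemLp u 2 (ν.prod (volume : Measure Circ)) then hilbertLp ν K (h.toLp u) else 0

end Fiber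

/-- The fiberwise Hilbert transform `H` on `L²(SM)`. -/
def hilbertSM (u : ℂ × Circ → ℂ) : ℂ × Circ → ℂ := hilbertOn (volume.restrict disc) Set.univ u

/-- The odd part `H₋` (that is, `H` restricted to odd harmonics) of the fiberwise Hilbert transform
on `L²(∂SM)`. -/
def hilbertOddBdry (u : Circ × Circ → ℂ) : Circ × Circ → ℂ :=
  hilbertOn (volume : Measure Circ) {k | Odd k} u

/-! ### Boundary operators and the X-ray transform -/

open Classical in
/-- `A_ε u`, with `ε = 1` for `A₊` and `ε = -1` for `A₋`: extension from `∂₊SM` to `∂SM`. -/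
def extA (ε : ℂ) (u : Circ × Circ → ℂ) (p : Circ × Circ) : ℂ :=
  if p ∈ inflow then u p else ε * u (scat p)

/-- The adjoint `A_ε^* u = u + ε u ∘ S` (to be read on `∂₊SM`). -/
def adjA (ε : ℂ) (u : Circ × Circ → ℂ) (p : Circ × Circ) : ℂ := u p + ε * u (scat p)

/-- `P₋^* = - A₊^* H₋ A₋`. -/
def adjPminus (u : Circ × Circ → ℂ) (p : Circ × Circ) : ℂ :=
  -adjA 1 (hilbertOddBdry (extA (-1) u)) p

/-- The X-ray transform `I₀ a` of a function on `M` (to be read on `∂₊SM`). -/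
def xray (a : ℂ → ℂ) (p : Circ × Circ) : ℂ := ∫ t in (0 : ℝ)..(2 * ccos p.2), a (flow p t).1

/-- The length of the geodesic from its entrance into the disc up to the point `(x, θ)`. -/
def backTime (q : ℂ × Circ) : ℝ :=
  (q.1 * (starRingEnd ℂ) (dir q.2)).re
    + √((q.1 * (starRingEnd ℂ) (dir q.2)).re ^ 2 + 1 - ‖q.1‖ ^ 2)

/-- The fan-beam coordinates of the point of `∂₊SM` where the geodesic through `(x, θ)` enters. -/
def entry (q : ℂ × Circ) : Circ × Circ :=
  let β : Circ := ((Complex.arg (q.1 - backTime q * dir q.2) : ℝ) : Circ)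
  (β, q.2 - β - piC)

/-- `h_ψ`: the function on `SM` that is constant along geodesics and equals `h` on `∂₊SM`. -/
def invExt (h : Circ × Circ → ℂ) (q : ℂ × Circ) : ℂ := h (entry q)

/-! ### Notions for functions on `SM` -/

/-- `w(x, -v) = -w(x, v)`. -/
def FiberwiseOdd (w : ℂ × Circ → ℂ) : Prop :=
  ∀ᵐ q ∂measSM, w (q.1, q.2 + piC) = -w q

/-- All angular Fourier coefficients of negative index vanish. -/
def FiberwiseHolomorphic (w : ℂ × Circ → ℂ) : Prop :=
  ∀ k : ℤ, k < 0 → ∀ᵐ x ∂(volume.restrict disc), ∫ θ : Circ, w (x, θ) * fourier (-k) θ = 0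

/-- Smooth functions on `SM`, written with a `2π`-periodic angular variable, that vanish near
the boundary of the disc. -/
structure IsTest (φ : ℂ × ℝ → ℂ) : Prop where
  smooth : ContDiff ℝ ∞ φ
  periodic : ∀ x θ, φ (x, θ + 2 * π) = φ (x, θ)
  support : ∃ r < 1, ∀ x θ, r < ‖x‖ → φ (x, θ) = 0

/-- The geodesic vector field `X = cos θ ∂_x + sin θ ∂_y`. -/
def geodX (φ : ℂ × ℝ → ℂ) (p : ℂ × ℝ) : ℂ :=
  fderiv ℝ φ p (Complex.exp (p.2 * Complex.I), 0)

/-- `Xw = f` in the sense of distributions on the interior of `SM`. -/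
def SolvesTransport (w f : ℂ × Circ → ℂ) : Prop :=
  ∀ φ : ℂ × ℝ → ℂ, IsTest φ →
    ∫ p in disc ×ˢ Ioc (0 : ℝ) (2 * π), w (p.1, (p.2 : Circ)) * geodX φ p =
      -∫ p in disc ×ˢ Ioc (0 : ℝ) (2 * π), f (p.1, (p.2 : Circ)) * φ p

/-- `w|_{∂₊SM} = ρ`: on almost every geodesic, `w` agrees almost everywhere with a function that is
continuous up to the two end points, and its value at the entrance is given by `ρ`. -/
def HasInflowTrace (w : ℂ × Circ → ℂ) (ρ : Circ × Circ → ℂ) : Prop :=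
  ∀ᵐ p ∂measInflow, ∃ c : ℝ → ℂ, ContinuousOn c (Icc 0 (2 * ccos p.2)) ∧
    (∀ᵐ t ∂(volume.restrict (Icc 0 (2 * ccos p.2))), w (flow p t) = c t) ∧ c 0 = ρ p

/-- `w|_{∂SM} = g`: the same, with the values at both ends of the geodesic. -/
def HasBdryTrace (w : ℂ × Circ → ℂ) (g : Circ × Circ → ℂ) : Prop :=
  ∀ᵐ p ∂measInflow, ∃ c : ℝ → ℂ, ContinuousOn c (Icc 0 (2 * ccos p.2)) ∧
    (∀ᵐ t ∂(volume.restrict (Icc 0 (2 * ccos p.2))), w (flow p t) = c t) ∧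
    c 0 = g p ∧ c (2 * ccos p.2) = g (scat p)

end

/-! ### The operators above do what they should -/

section
variable {Y : Type*} [MeasurableSpace Y] (ν : Measure Y)
theorem harm_mem {K : Set ℤ} {k : ℤ} (hk : k ∈ K) (u : L2 ν) (f : Y → ℂ)
    (hu : u =ᵐ[ν.prod volume] fun p => f p.1 * fourier k p.2) : u ∈ harmonicSpace ν K :=
  Submodule.le_topologicalClosure _ (Submodule.subset_span ⟨k, hk, f, hu⟩)

theorem integral_fourier {k : ℤ} (hk : k ≠ 0) : ∫ θ : Circ, fourier k θ = 0 := by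
  have hT : 0 < 2 * π := Real.two_pi_pos
  have h := integral_add_right_eq_self (μ := (volume : Measure Circ)) (fun θ : Circ => fourier k θ)
    (((2 * π) / 2 / k : ℝ) : Circ)
  have h2 : ∀ θ : Circ, fourier k (θ + (((2 * π) / 2 / k : ℝ) : Circ)) = -fourier k θ :=
    fun θ => fourier_add_half_inv_index hk hT θ
  simp only [h2, integral_neg] at h
  linear_combination (-1/2 : ℂ) * h

theorem harm_orth [SFinite ν] {k l : ℤ} (hkl : k ≠ l) (u v : L2 ν) (f g : Y → ℂ)
    (hu : u =ᵐ[ν.prod volume] fun p => f p.1 * fourier k p.2)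
    (hv : v =ᵐ[ν.prod volume] fun p => g p.1 * fourier l p.2) : inner ℂ u v = 0 := by
  rw [MeasureTheory.L2.inner_def]
  have h : (fun p => inner ℂ (u p) (v p)) =ᵐ[ν.prod volume]
      fun p : Y × Circ => (g p.1 * (starRingEnd ℂ) (f p.1)) * fourier (l - k) p.2 := by
    filter_upwards [hu, hv] with p h1 h2
    rw [h1, h2, sub_eq_add_neg, fourier_add, fourier_neg]
    simp only [RCLike.inner_apply, map_mul]
    ring
  rw [integral_congr_ae h, integral_prod_mul (fun y => g y * (starRingEnd ℂ) (f y))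
    (fun θ : Circ => fourier (l - k) θ), integral_fourier (sub_ne_zero.mpr hkl.symm), mul_zero]

theorem harmonicProj_harmonic [SFinite ν] (K : Set ℤ) [DecidablePred (· ∈ K)] {k : ℤ} (u : L2 ν)
    (f : Y → ℂ) (hu : u =ᵐ[ν.prod volume] fun p => f p.1 * fourier k p.2) :
    harmonicProj ν K u = if k ∈ K then u else 0 := by
  split_ifs with hk
  · exact Submodule.starProjection_eq_self_iff.mpr (harm_mem ν hk u f hu)
  · refine (Submodule.starProjection_apply_eq_zero_iff _).mpr ?_
    rw [harmonicSpace, Submodule.orthogonal_closure, Submodule.mem_orthogonal]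
    intro v hv
    induction hv using Submodule.span_induction with
    | mem v hv =>
      obtain ⟨l, hl, g, hg⟩ := hv
      exact harm_orth ν (by rintro rfl; exact hk hl) v u g f hg hu
    | zero => simp
    | add x y _ _ hx hy => rw [inner_add_left, hx, hy, add_zero]
    | smul c x _ hx => rw [inner_smul_left, hx, mul_zero]

/-- The defining formula of the Hilbert transform. -/
theorem hilbertLp_harmonic [SFinite ν] (K : Set ℤ) [DecidablePred (· ∈ K)] {k : ℤ} (u : L2 ν)
    (f : Y → ℂ) (hu : u =ᵐ[ν.prod volume] fun p => f p.1 * fourier k p.2) :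
    hilbertLp ν K u = (if k ∈ K then -Complex.I * (Int.sign k : ℂ) else 0) • u := by
  classical
  simp only [hilbertLp, smul_apply, sub_apply,
    harmonicProj_harmonic ν _ u f hu, Set.mem_inter_iff, Set.mem_ofPred_eq]
  by_cases hk : k ∈ K
  · rcases lt_trichotomy k 0 with h | h | h
    · simp [hk, h, h.not_gt, Int.sign_eq_neg_one_of_neg h]
    · simp [h]
    · simp [hk, h, h.not_gt, Int.sign_eq_one_of_pos h]
  · simp [hk]
end

theorem dir_add (x y : Circ) : dir (x + y) = dir x * dir y := by
  simp [dir, AddCircle.toCircle_add]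
theorem dir_piC : dir piC = -1 := by
  rw [dir, piC, fourier_coe_apply]
  have : 2 * (π:ℂ) * Complex.I * (1:ℤ) * (π:ℝ) / ((2 * π : ℝ):ℂ) = π * Complex.I := by
    have : (π:ℂ) ≠ 0 := by exact_mod_cast Real.pi_ne_zero
    push_cast; field_simp
  rw [this, Complex.exp_pi_mul_I]
theorem dir_norm (x : Circ) : ‖dir x‖ = 1 := by
  rw [dir, fourier_apply]; exact Circle.norm_coe _
theorem dir_conj (x : Circ) : dir x * (starRingEnd ℂ) (dir x) = 1 := by
  rw [Complex.mul_conj, Complex.normSq_eq_norm_sq, dir_norm]; simp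
theorem arg_dir (x : Circ) : ((Complex.arg (dir x) : ℝ) : Circ) = x := by
  induction x using QuotientAddGroup.induction_on with
  | H x =>
  have h : dir (x : Circ) = Complex.exp (x * Complex.I) := by
    rw [dir]
    erw [fourier_coe_apply]
    congr 1
    have : (π:ℂ) ≠ 0 := by exact_mod_cast Real.pi_ne_zero
    push_cast; field_simp
  erw [h]
  rw [Complex.arg_exp_mul_I]
  have h2 := toIocMod_add_toIocDiv_zsmul Real.two_pi_pos (-π) x
  conv_rhs => rw [← h2]
  rw [AddCircle.coe_add]
  have : ((toIocDiv Real.two_pi_pos (-π) x • (2 * π) : ℝ) : Circ) = 0 := by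
    rw [AddCircle.coe_zsmul, AddCircle.coe_period, smul_zero]
  rw [this, add_zero]

/-- `h_ψ` is constant along the geodesics and equals `h` on `∂₊SM`. -/
theorem invExt_flow (h : Circ × Circ → ℂ) (p : Circ × Circ) (hp : p ∈ inflow) (t : ℝ)
    (ht : t ∈ Icc 0 (2 * ccos p.2)) : invExt h (flow p t) = h p := by
  obtain ⟨β, α⟩ := p
  have hc : 0 ≤ ccos α := hp
  have e1 : dir (β + piC + α) = -(dir β * dir α) := by rw [dir_add, dir_add, dir_piC]; ring
  have hb := dir_conj β
  have ha := dir_conj α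
  have e2 : (dir β + t * dir (β + piC + α)) * (starRingEnd ℂ) (dir (β + piC + α))
      = t - (starRingEnd ℂ) (dir α) := by
    rw [e1, map_neg, map_mul]
    linear_combination (-(starRingEnd ℂ) (dir α) + t * (dir α * (starRingEnd ℂ) (dir α))) * hb
      + t * ha
  have e3 : ((dir β + t * dir (β + piC + α)) * (starRingEnd ℂ) (dir (β + piC + α))).re
      = t - ccos α := by rw [e2]; simp [ccos]
  have e4 : ‖dir β + t * dir (β + piC + α)‖ ^ 2 = 1 - 2 * t * ccos α + t ^ 2 := by
    have : ‖dir β + t * dir (β + piC + α)‖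
        = ‖(dir β + t * dir (β + piC + α)) * (starRingEnd ℂ) (dir (β + piC + α))‖ := by
      rw [norm_mul, RCLike.norm_conj, dir_norm, mul_one]
    rw [this, e2, ← Complex.normSq_eq_norm_sq, Complex.normSq_apply]
    have h1 : (dir α).re ^ 2 + (dir α).im ^ 2 = 1 := by
      have := dir_norm α
      rw [← sq_eq_sq₀ (norm_nonneg _) zero_le_one, ← Complex.normSq_eq_norm_sq,
        Complex.normSq_apply] at this
      linarith
    simp [ccos]
    linear_combination h1
  have e5 : backTime (flow (β, α) t) = t := by
    simp only [backTime, flow]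
    rw [e3, e4]
    have : (t - ccos α) ^ 2 + 1 - (1 - 2 * t * ccos α + t ^ 2) = ccos α ^ 2 := by ring
    rw [this, Real.sqrt_sq hc]; ring
  have e6 : entry (flow (β, α) t) = (β, α) := by
    simp only [entry]
    rw [e5]
    simp only [flow, add_sub_cancel_right, arg_dir]
    congr 1
    abel
  rw [invExt, e6]

/-- The geodesic issued from `p ∈ ∂₊SM` ends at the boundary point with fan-beam coordinates
`scat p`. -/
theorem flow_end (p : Circ × Circ) :
    flow p (2 * ccos p.2) = (dir (scat p).1, (scat p).1 + piC + (scat p).2) := by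
  obtain ⟨β, α⟩ := p
  have ha := dir_conj α
  have h2 : ((2 * ccos α : ℝ) : ℂ) = dir α + (starRingEnd ℂ) (dir α) := by
    rw [Complex.add_conj]; simp [ccos]
  have hpp : piC + piC = 0 := by
    rw [piC, ← AddCircle.coe_add, ← two_mul, AddCircle.coe_period]
  simp only [flow, scat, Prod.mk.injEq]
  constructor
  · rw [h2, two_smul]; simp only [dir_add, dir_piC]; linear_combination -(dir β) * ha
  · rw [two_smul]
    calc β + piC + α = β + piC + α + (piC + piC) := by rw [hpp, add_zero]
      _ = _ := by abel

end DiscTransport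

open DiscTransport

namespace DiscTransport

/-! ### Harmonic subspaces -/

section Harmonic

variable {Y : Type*} [MeasurableSpace Y] {ν : Measure Y}

/-! Suppose there are V with odd positive frequencies and XV = -a, and V' with odd negative
frequencies and XV' = a, such that V' = V ∘ S on ∂SM (`TransportPair`). Then V + V' is constant
along geodesics, and integration along them gives A₋I₀a = V - V' on ∂SM. Over a fixed β, frequencies
in α are frequencies in θ, so H₋ turns V - V' into -i(V + V'), which is S-invariant. Hence n = (V +
V')/(4πi), and n_ψ is given by the same expression on SM. Applying H once more gives Hn_ψ = -(V -
V')/(4π), so that w = V.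

Such pairs exist for every monomial z^j z̄^l (`monomial_mem_pairSpace`). The functions e^{imθ}σ^q
with σ = z e^{-iθ} - z̄ e^{iθ} are constant along geodesics. Cutting the Fourier expansion of a
suitable one at frequency 0 gives two halves whose X-derivatives are opposite multiples of one
monomial (`splitsWith_ridge`). The boundary relation requires combining several of them: on ∂SM one
has σ = x + y with x = -e^{-iα}, y = e^{iα}, xy = -1, and S exchanges x and y. Writing x^q + y^q as
a polynomial in x + y (`exists_powerSum`) leaves only two frequencies in α, one in each half
(`bdry_of_sum`). The extra lower-order monomials are removed by induction.

Polynomials in z and z̄ are dense in C(M), and n_ψ, Hn_ψ and w depend continuously in L²(SM) on a in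
C(M); the bound for h ↦ h_ψ comes from Santaló's formula (`santalo`, `map_entry_le`). So closed
linear conditions extend to all a: membership of w in the odd positive harmonics (`solutionLp_mem`),
the weak transport equation (`solvesTransport_solutionLp`), and the identity of -2πHn_ψ with half
the signed integral of a along the geodesic (`hilbertInvariantLp_eq_signedRayLp`).

Convergence in L² alone does not control traces. The last identity does: it writes w as 2πi n_ψ plus
an explicit function, continuous along geodesics, and Santaló's formula carries this almost
everywhere identity to almost every geodesic (`ae_flow_of_ae`). Finally, n is antisymmetric under
the antipodal scattering relation because H₋ produces functions that are odd in the fiber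
(`ae_scatA_eq_neg`). -/

theorem norm_fourier_apply (k : ℤ) (θ : Circ) : ‖fourier k θ‖ = 1 := by
  rw [fourier_apply]; exact Circle.norm_coe _

theorem harmonicSpace_mono {K K' : Set ℤ} (h : K ⊆ K') :
    harmonicSpace ν K ≤ harmonicSpace ν K' := by
  refine Submodule.topologicalClosure_mono (Submodule.span_mono ?_)
  rintro u ⟨k, hk, f, hf⟩
  exact ⟨k, h hk, f, hf⟩

theorem harmonicSpace_isOrtho [SFinite ν] {K K' : Set ℤ} (h : Disjoint K K') :
    harmonicSpace ν K ⟂ harmonicSpace ν K' := by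
  have key : Submodule.span ℂ {u : L2 ν | ∃ k ∈ K, ∃ f : Y → ℂ,
      u =ᵐ[ν.prod volume] fun p => f p.1 * fourier k p.2} ⟂
      Submodule.span ℂ {u : L2 ν | ∃ k ∈ K', ∃ f : Y → ℂ,
      u =ᵐ[ν.prod volume] fun p => f p.1 * fourier k p.2} := by
    rw [Submodule.isOrtho_span]
    rintro u ⟨k, hk, f, hf⟩ v ⟨l, hl, g, hg⟩
    exact harm_orth ν (by rintro rfl; exact Set.disjoint_left.mp h hk hl) u v f g hf hg
  rw [Submodule.IsOrtho] at key ⊢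
  unfold harmonicSpace
  rw [Submodule.orthogonal_closure]
  exact Submodule.topologicalClosure_minimal _ key (Submodule.isClosed_orthogonal _)

theorem harmonicProj_of_subset {K L : Set ℤ} (h : L ⊆ K) {u : L2 ν} (hu : u ∈ harmonicSpace ν L) :
    harmonicProj ν K u = u :=
  Submodule.starProjection_eq_self_iff.mpr (harmonicSpace_mono h hu)

theorem harmonicProj_of_disjoint [SFinite ν] {K L : Set ℤ} (h : Disjoint K L) {u : L2 ν}
    (hu : u ∈ harmonicSpace ν L) : harmonicProj ν K u = 0 :=
  (Submodule.starProjection_apply_eq_zero_iff _).mpr ((harmonicSpace_isOrtho h.symm) hu)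

theorem hilbertLp_of_pos [SFinite ν] {K L : Set ℤ} (h : L ⊆ K ∩ {k | 0 < k}) {u : L2 ν}
    (hu : u ∈ harmonicSpace ν L) : hilbertLp ν K u = -Complex.I • u := by
  have hd : Disjoint (K ∩ {k : ℤ | k < 0}) L := by
    rw [Set.disjoint_left]
    intro k hk hl
    have h1 := hk.2
    have h2 := (h hl).2
    simp only [Set.mem_ofPred_eq] at h1 h2
    exact lt_asymm h1 h2
  simp [hilbertLp, harmonicProj_of_subset h hu, harmonicProj_of_disjoint hd hu]

theorem hilbertLp_of_neg [SFinite ν] {K L : Set ℤ} (h : L ⊆ K ∩ {k | k < 0}) {u : L2 ν}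
    (hu : u ∈ harmonicSpace ν L) : hilbertLp ν K u = Complex.I • u := by
  have hd : Disjoint (K ∩ {k : ℤ | 0 < k}) L := by
    rw [Set.disjoint_left]
    intro k hk hl
    have h1 := hk.2
    have h2 := (h hl).2
    simp only [Set.mem_ofPred_eq] at h1 h2
    exact lt_asymm h1 h2
  simp [hilbertLp, harmonicProj_of_subset h hu, harmonicProj_of_disjoint hd hu]

theorem hilbertLp_mem (K : Set ℤ) (u : L2 ν) : hilbertLp ν K u ∈ harmonicSpace ν K := by
  have h1 : ∀ L : Set ℤ, harmonicProj ν (K ∩ L) u ∈ harmonicSpace ν K := fun L =>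
    harmonicSpace_mono Set.inter_subset_left (Submodule.starProjection_apply_mem _ _)
  simp only [hilbertLp, smul_apply, sub_apply]
  exact Submodule.smul_mem _ _ (Submodule.sub_mem _ (h1 _) (h1 _))

theorem hilbertOn_of_memLp (K : Set ℤ) {u : Y × Circ → ℂ}
    (h : MemLp u 2 (ν.prod (volume : Measure Circ))) :
    hilbertOn ν K u = hilbertLp ν K (h.toLp u) := by
  rw [hilbertOn, dif_pos h]

theorem measurePreserving_fiberShift [SFinite ν] :
    MeasurePreserving (fun p : Y × Circ => (p.1, p.2 + piC)) (ν.prod volume) (ν.prod volume) :=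
  (MeasurePreserving.id ν).prod (measurePreserving_add_right volume piC)

theorem fourier_eq_zpow (k : ℤ) (θ : Circ) : (fourier k θ : ℂ) = dir θ ^ k := by
  simp [dir, fourier_apply, AddCircle.toCircle_zsmul]

theorem fourier_add_piC {k : ℤ} (hk : Odd k) (θ : Circ) : fourier k (θ + piC) = -fourier k θ := by
  rw [fourier_eq_zpow, fourier_eq_zpow, dir_add, mul_zpow, dir_piC, hk.neg_one_zpow]
  ring

/-- The shift by π plus the identity is a bounded operator, so its kernel is closed and only the
generators need testing; there e^{ikπ} = -1. -/
theorem ae_odd_of_mem_harmonicSpace [SFinite ν] {K : Set ℤ} (hK : ∀ k ∈ K, Odd k) {u : L2 ν}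
    (hu : u ∈ harmonicSpace ν K) :
    ∀ᵐ p ∂(ν.prod (volume : Measure Circ)), u (p.1, p.2 + piC) = -u p := by
  let T : L2 ν →L[ℂ] L2 ν := (Lp.compMeasurePreservingₗᵢ ℂ (fun p : Y × Circ => (p.1, p.2 + piC))
    (measurePreserving_fiberShift (ν := ν))).toContinuousLinearMap
  have hT : ∀ v : L2 ν, T v =ᵐ[ν.prod volume] fun p => v (p.1, p.2 + piC) := fun v =>
    Lp.coeFn_compMeasurePreserving v measurePreserving_fiberShift
  have key : harmonicSpace ν K ≤ (T + ContinuousLinearMap.id ℂ (L2 ν)).ker := by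
    refine Submodule.topologicalClosure_minimal _ (Submodule.span_le.mpr ?_)
      (ContinuousLinearMap.isClosed_ker _)
    rintro v ⟨k, hk, f, hf⟩
    show T v + v = 0
    rw [Lp.eq_zero_iff_ae_eq_zero]
    filter_upwards [Lp.coeFn_add (T v) v, hT v, hf,
      measurePreserving_fiberShift.quasiMeasurePreserving.ae hf] with p h1 h2 h3 h4
    rw [h1, Pi.add_apply, h2, h4, h3, fourier_add_piC (hK k hk)]
    simp
  have h0 : T u + u = 0 := key hu
  filter_upwards [Lp.coeFn_add (T u) u, hT u, Lp.eq_zero_iff_ae_eq_zero.mp h0] with p h1 h2 h3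
  rw [h3, Pi.zero_apply, Pi.add_apply, h2] at h1
  exact eq_neg_of_add_eq_zero_left h1.symm

/-- Pairing u with 1_s(y) e^{ikθ}, which is orthogonal to the harmonics in `K`, shows that the k-th
coefficient has integral zero over every measurable s. -/
theorem ae_integral_fourier_eq_zero [IsFiniteMeasure ν] {K : Set ℤ} {k : ℤ} (hk : k ∉ K) {u : L2 ν}
    (hu : u ∈ harmonicSpace ν K) :
    ∀ᵐ y ∂ν, ∫ θ : Circ, u (y, θ) * fourier (-k) θ = 0 := by
  have hui : Integrable u (ν.prod (volume : Measure Circ)) :=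
    (Lp.memLp u).integrable (by norm_num)
  have hint : Integrable (fun p : Y × Circ => u p * fourier (-k) p.2) (ν.prod volume) := by
    refine hui.mul_bdd (c := 1) ?_ ?_
    · exact ((fourier (-k)).continuous.measurable.comp measurable_snd).aestronglyMeasurable
    · exact Filter.Eventually.of_forall fun p => (norm_fourier_apply _ _).le
  refine ae_eq_zero_of_forall_setIntegral_eq_of_sigmaFinite (fun s _ _ =>
    hint.integral_prod_left.integrableOn) fun s hs _ => ?_
  have hm : MemLp (fun p : Y × Circ => s.indicator (fun _ => (1 : ℂ)) p.1 * fourier k p.2) 2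
      (ν.prod volume) := by
    refine MemLp.of_bound (C := 1) ?_ ?_
    · exact ((((measurable_const.indicator hs).comp measurable_fst)).mul
        ((fourier k).continuous.measurable.comp measurable_snd)).aestronglyMeasurable
    · refine Filter.Eventually.of_forall fun p => ?_
      by_cases hp : p.1 ∈ s <;> simp [hp, norm_fourier_apply, -fourier_apply]
  have h0 : inner ℂ (hm.toLp _) u = 0 := by
    refine (harmonicSpace_isOrtho (K := {k}) (K' := K) (by simpa using hk)).inner_eq ?_ hu
    exact harm_mem ν (Set.mem_singleton k) _ (s.indicator fun _ => (1 : ℂ)) hm.coeFn_toLp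
  rw [MeasureTheory.L2.inner_def] at h0
  have h1 : (fun p => inner ℂ ((hm.toLp _ : L2 ν) p) (u p)) =ᵐ[ν.prod volume]
      fun p : Y × Circ => (s ×ˢ (univ : Set Circ)).indicator
        (fun p => u p * fourier (-k) p.2) p := by
    filter_upwards [hm.coeFn_toLp] with p hp
    rw [hp]
    by_cases h : p.1 ∈ s
    · simp [h]
    · simp [h]
  rw [integral_congr_ae h1, integral_indicator (hs.prod MeasurableSet.univ),
    setIntegral_prod _ hint.integrableOn] at h0
  simpa using h0

end Harmonic

/-! ### Santaló's formula -/

open scoped ENNReal ComplexConjugate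

theorem dir_coe (x : ℝ) : dir (x : Circ) = Complex.exp (x * Complex.I) := by
  rw [dir]
  erw [fourier_coe_apply]
  congr 1
  have : (π : ℂ) ≠ 0 := by exact_mod_cast Real.pi_ne_zero
  push_cast; field_simp

theorem dir_coe' (x : ℝ) : dir (x : Circ) = Real.cos x + Real.sin x * Complex.I := by
  rw [dir_coe, Complex.exp_mul_I]; simp

theorem ccos_coe (x : ℝ) : ccos (x : Circ) = Real.cos x := by
  rw [ccos, dir_coe']; simp [Complex.cos_ofReal_re]

theorem continuous_dir : Continuous dir := (fourier 1).continuous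

theorem continuous_ccos : Continuous ccos := Complex.continuous_re.comp continuous_dir

theorem measurableSet_inflow : MeasurableSet inflow :=
  (isClosed_le continuous_const (continuous_ccos.comp continuous_snd)).measurableSet

theorem continuous_flow : Continuous fun x : (Circ × Circ) × ℝ => flow x.1 x.2 := by
  have := continuous_dir
  unfold flow
  fun_prop

theorem measurable_disc : MeasurableSet disc := Metric.isClosed_closedBall.measurableSet

instance : IsFiniteMeasure (volume.restrict disc) :=
  ⟨by rw [Measure.restrict_apply_univ]; exact (isCompact_closedBall (0 : ℂ) 1).measure_lt_top⟩

theorem lintegral_disc_rotate (v : ℂ) (hv : ‖v‖ = 1) (F : ℂ → ℝ≥0∞) :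
    ∫⁻ z in disc, F z = ∫⁻ z in disc, F (v * z) := by
  let c : Circle := ⟨v, by simpa [Submonoid.unitSphere] using hv⟩
  have hm : MeasurePreserving (rotation c) (volume : Measure ℂ) volume :=
    LinearIsometryEquiv.measurePreserving _
  rw [← lintegral_indicator measurable_disc, ← lintegral_indicator measurable_disc,
    ← hm.lintegral_comp_emb (rotation c).toHomeomorph.measurableEmbedding]
  refine lintegral_congr fun z => ?_
  have : rotation c z = v * z := rfl
  rw [this]
  have h2 : v * z ∈ disc ↔ z ∈ disc := by simp [disc, hv]
  by_cases h : z ∈ disc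
  · rw [indicator_of_mem h, indicator_of_mem (h2.mpr h)]
  · rw [indicator_of_notMem h, indicator_of_notMem (fun h' => h (h2.mp h'))]

/-- The disc is sliced into horizontal chords: the chord at height sin α is entered at -e^{-iα} and
has length 2 cos α, and cos α is the Jacobian of the height. -/
theorem lintegral_disc_chords (F : ℂ → ℝ≥0∞) (hF : Measurable F) :
    ∫⁻ z in disc, F z = ∫⁻ α in Ioo (-(π / 2)) (π / 2), ENNReal.ofReal (Real.cos α) *
      ∫⁻ t in Icc 0 (2 * Real.cos α), F (t - (starRingEnd ℂ) (dir (α : Circ))) := by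
  have h1 : ∫⁻ z in disc, F z = ∫⁻ y : ℝ, ∫⁻ x : ℝ,
      disc.indicator F (x + y * Complex.I) := by
    rw [← lintegral_indicator measurable_disc,
      ← Complex.volume_preserving_equiv_real_prod.symm.lintegral_comp_emb
        Complex.measurableEquivRealProd.symm.measurableEmbedding, Measure.volume_eq_prod,
      lintegral_prod_symm]
    · refine lintegral_congr fun y => lintegral_congr fun x => ?_
      congr 1
      apply Complex.ext <;> simp [Complex.measurableEquivRealProd_symm_apply]
    · exact ((hF.indicator measurable_disc).comp
        Complex.measurableEquivRealProd.symm.measurable).aemeasurable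
  have hsin : Real.sin '' Ioo (-(π / 2)) (π / 2) = Ioo (-1) 1 := by
    apply Subset.antisymm
    · rintro _ ⟨x, hx, rfl⟩
      have hc := Real.cos_pos_of_mem_Ioo hx
      have := Real.sin_sq_add_cos_sq x
      constructor <;> nlinarith
    · intro y hy
      refine ⟨Real.arcsin y, ⟨Real.neg_pi_div_two_lt_arcsin.mpr hy.1,
        Real.arcsin_lt_pi_div_two.mpr hy.2⟩, Real.sin_arcsin hy.1.le hy.2.le⟩
  have hmem : ∀ x y : ℝ, ((x : ℂ) + y * Complex.I) ∈ disc ↔ x ^ 2 + y ^ 2 ≤ 1 := by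
    intro x y
    rw [disc, mem_closedBall_zero_iff, ← sq_le_one_iff₀ (norm_nonneg _),
      ← Complex.normSq_eq_norm_sq, Complex.normSq_add_mul_I]
  have h2 : ∫⁻ y : ℝ, ∫⁻ x : ℝ, disc.indicator F (x + y * Complex.I) =
      ∫⁻ y in Ioo (-1 : ℝ) 1, ∫⁻ x : ℝ, disc.indicator F (x + y * Complex.I) := by
    rw [setLIntegral_congr (Ioo_ae_eq_Icc (a := (-1 : ℝ)) (b := 1)),
      ← lintegral_indicator measurableSet_Icc]
    refine lintegral_congr fun y => ?_
    by_cases hy : y ∈ Icc (-1 : ℝ) 1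
    · rw [indicator_of_mem hy]
    · rw [indicator_of_notMem hy, lintegral_eq_zero_of_ae_eq_zero]
      refine Filter.Eventually.of_forall fun x => ?_
      apply indicator_of_notMem
      rw [hmem]
      intro h
      apply hy
      have : y ^ 2 ≤ 1 := by nlinarith [sq_nonneg x]
      exact abs_le.mp ((sq_le_one_iff_abs_le_one y).mp this)
  rw [h1, h2, ← hsin, lintegral_image_eq_lintegral_abs_deriv_mul measurableSet_Ioo
    (fun x _ => (Real.hasDerivAt_sin x).hasDerivWithinAt)
    (Real.injOn_sin.mono Ioo_subset_Icc_self)]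
  refine setLIntegral_congr_fun measurableSet_Ioo fun α hα => ?_
  have hc := Real.cos_pos_of_mem_Ioo hα
  -- The abscissa is t - cos α, with t the arc length from the left end of the chord.
  rw [abs_of_pos hc, ← lintegral_indicator measurableSet_Icc,
    ← lintegral_sub_right_eq_self _ (Real.cos α)]
  congr 1
  refine lintegral_congr fun t => ?_
  have e : (((t - Real.cos α : ℝ) : ℂ) + Real.sin α * Complex.I)
      = t - (starRingEnd ℂ) (dir (α : Circ)) := by
    rw [dir_coe', map_add, map_mul, Complex.conj_ofReal, Complex.conj_ofReal, Complex.conj_I]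
    push_cast
    ring
  have hiff : (((t - Real.cos α : ℝ) : ℂ) + Real.sin α * Complex.I) ∈ disc ↔
      t ∈ Icc 0 (2 * Real.cos α) := by
    rw [hmem, ← Real.sin_sq_add_cos_sq α]
    constructor
    · intro h
      constructor <;> nlinarith
    · rintro ⟨h3, h4⟩
      nlinarith
  by_cases ht : t ∈ Icc 0 (2 * Real.cos α)
  · rw [indicator_of_mem ht, indicator_of_mem (hiff.mpr ht), e]
  · rw [indicator_of_notMem ht, indicator_of_notMem (fun h => ht (hiff.mp h))]

theorem lintegral_inflow (Q : Circ × Circ → ℝ≥0∞) (hQ : Measurable Q) :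
    ∫⁻ p, Q p ∂measInflow =
      ∫⁻ α in Ioo (-(π / 2)) (π / 2), ∫⁻ β : Circ, Q (β, ((α : ℝ) : Circ)) := by
  rw [measInflow, ← lintegral_indicator measurableSet_inflow, measBdry,
    lintegral_prod_symm _ (hQ.indicator measurableSet_inflow).aemeasurable,
    ← AddCircle.lintegral_preimage (2 * π) (-π),
    setLIntegral_congr (Ioo_ae_eq_Icc (a := -(π / 2)) (b := π / 2)),
    ← lintegral_indicator measurableSet_Icc, ← lintegral_indicator measurableSet_Ioc]
  refine lintegral_congr fun α => ?_
  by_cases h : α ∈ Icc (-(π / 2)) (π / 2)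
  · have h' : α ∈ Ioc (-π) (-π + 2 * π) := ⟨by linarith [h.1, Real.pi_pos],
      by linarith [h.2, Real.pi_pos]⟩
    rw [indicator_of_mem h, indicator_of_mem h']
    refine lintegral_congr fun β => indicator_of_mem ?_ _
    show 0 ≤ ccos (α : Circ)
    rw [ccos_coe]
    exact Real.cos_nonneg_of_mem_Icc h
  · rw [indicator_of_notMem h]
    by_cases h' : α ∈ Ioc (-π) (-π + 2 * π)
    · rw [indicator_of_mem h', lintegral_eq_zero_of_ae_eq_zero]
      refine Filter.Eventually.of_forall fun β => indicator_of_notMem ?_ _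
      show ¬ 0 ≤ ccos (α : Circ)
      rw [ccos_coe, not_le]
      rw [Set.mem_Icc, not_and_or, not_le, not_le] at h
      rcases h with h | h
      · rw [← Real.cos_neg]
        exact Real.cos_neg_of_pi_div_two_lt_of_lt (by linarith) (by linarith [h'.1, Real.pi_pos])
      · exact Real.cos_neg_of_pi_div_two_lt_of_lt h (by linarith [h'.2, Real.pi_pos])
    · rw [indicator_of_notMem h']

/-- For fixed θ, a rotation makes the direction horizontal and the chord decomposition applies, with
entry point β = θ - π - α. Tonelli and translation invariance in θ then replace θ by β. -/
theorem santalo (F : ℂ × Circ → ℝ≥0∞) (hF : Measurable F) :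
    ∫⁻ q, F q ∂measSM = ∫⁻ p, (∫⁻ t in Icc 0 (2 * ccos p.2),
      F (flow p t) * ENNReal.ofReal (ccos p.2)) ∂measInflow := by
  have hmJ : Measurable fun x : Circ × Circ => ENNReal.ofReal (ccos x.2) *
      ∫⁻ t in Icc 0 (2 * ccos x.2), F (flow x t) := by
    refine (ENNReal.measurable_ofReal.comp
      (continuous_ccos.measurable.comp measurable_snd)).mul ?_
    have hs : MeasurableSet {y : (Circ × Circ) × ℝ | y.2 ∈ Icc 0 (2 * ccos y.1.2)} :=
      (measurableSet_le measurable_const measurable_snd).inter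
        (measurableSet_le measurable_snd
          ((continuous_ccos.measurable.comp (by fun_prop)).const_mul 2))
    have := (((hF.comp continuous_flow.measurable).indicator hs).lintegral_prod_right'
      (ν := (volume : Measure ℝ)))
    convert! this using 2 with x
    rw [← lintegral_indicator measurableSet_Icc]
    rfl
  have e1 : ∀ p : Circ × Circ, ∫⁻ t in Icc 0 (2 * ccos p.2),
      F (flow p t) * ENNReal.ofReal (ccos p.2) = ENNReal.ofReal (ccos p.2) *
      ∫⁻ t in Icc 0 (2 * ccos p.2), F (flow p t) := fun p => by
    rw [lintegral_mul_const', mul_comm]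
    exact ENNReal.ofReal_ne_top
  simp_rw [e1]
  rw [lintegral_inflow _ hmJ, measSM, lintegral_prod_symm _ hF.aemeasurable]
  have e2 : ∀ θ : Circ, ∫⁻ z in disc, F (z, θ) = ∫⁻ α in Ioo (-(π / 2)) (π / 2),
      ENNReal.ofReal (ccos ((α : ℝ) : Circ)) * ∫⁻ t in Icc 0 (2 * ccos ((α : ℝ) : Circ)),
        F (flow (θ - piC - ((α : ℝ) : Circ), ((α : ℝ) : Circ)) t) := by
    intro θ
    rw [lintegral_disc_rotate (dir θ) (dir_norm θ), lintegral_disc_chords]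
    · simp_rw [ccos_coe]
      refine lintegral_congr fun α => ?_
      congr 1
      refine lintegral_congr fun t => ?_
      congr 1
      have h1 : θ - piC - (α : Circ) + piC + (α : Circ) = θ := by abel
      rw [flow, h1]
      refine Prod.ext ?_ rfl
      have h2 := dir_conj (α : Circ)
      have h3 : dir θ = -(dir (θ - piC - (α : Circ)) * dir (α : Circ)) := by
        conv_lhs => rw [← h1]
        rw [dir_add, dir_add, dir_piC]
        ring
      simp only
      linear_combination -(starRingEnd ℂ) (dir (α : Circ)) * h3 + dir (θ - piC - (α : Circ)) * h2
    · fun_prop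
  simp_rw [e2]
  rw [lintegral_lintegral_swap]
  · refine lintegral_congr fun α => ?_
    simp_rw [sub_sub]
    exact lintegral_sub_right_eq_self (fun β : Circ => ENNReal.ofReal (ccos ((α : ℝ) : Circ)) *
      ∫⁻ t in Icc 0 (2 * ccos ((α : ℝ) : Circ)), F (flow (β, ((α : ℝ) : Circ)) t)) _
  · have hg : Measurable fun x : Circ × ℝ => (x.1 - piC - ((x.2 : ℝ) : Circ), ((x.2 : ℝ) : Circ)) := by
      have : Measurable fun x : ℝ => (x : Circ) := (AddCircle.continuous_mk' _).measurable
      fun_prop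
    exact (hmJ.comp hg).aemeasurable

/-! ### Geodesics and their entry points -/

theorem entry_flow {p : Circ × Circ} (hp : p ∈ inflow) {t : ℝ} (ht : t ∈ Icc 0 (2 * ccos p.2)) :
    entry (flow p t) = p := by
  classical
  -- Constancy along geodesics is applied to the indicator function of the point p, which detects
  -- the entry point.
  have h := invExt_flow (fun x => if x = p then 1 else 0) p hp t ht
  by_contra hne
  simp [invExt, hne] at h

/-- The distance from the foot point `(x, θ)` to the midpoint of the chord, with sign. -/
noncomputable def chordCoord (q : ℂ × Circ) : ℝ := (q.1 * (starRingEnd ℂ) (dir q.2)).re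

/-- Half of the length of the chord through `(x, θ)`. -/
noncomputable def chordHalf (q : ℂ × Circ) : ℝ := √(chordCoord q ^ 2 + 1 - ‖q.1‖ ^ 2)

theorem backTime_eq (q : ℂ × Circ) : backTime q = chordCoord q + chordHalf q := rfl

theorem continuous_chordCoord : Continuous chordCoord := by
  have := continuous_dir
  unfold chordCoord
  exact Complex.continuous_re.comp (continuous_fst.mul
    (Complex.continuous_conj.comp (this.comp continuous_snd)))

theorem continuous_chordHalf : Continuous chordHalf := by
  have := continuous_chordCoord
  unfold chordHalf
  fun_prop

theorem continuous_backTime : Continuous backTime :=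
  continuous_chordCoord.add continuous_chordHalf

theorem measurable_entry : Measurable entry := by
  have h1 : Measurable fun x : ℝ => (x : Circ) := (AddCircle.continuous_mk' _).measurable
  have h2 := continuous_dir.measurable
  have h3 := continuous_backTime.measurable
  have h4 : Measurable fun q : ℂ × Circ =>
      ((Complex.arg (q.1 - backTime q * dir q.2) : ℝ) : Circ) :=
    h1.comp (Complex.measurable_arg.comp (measurable_fst.sub
      ((Complex.measurable_ofReal.comp h3).mul (h2.comp measurable_snd))))
  exact h4.prodMk ((measurable_snd.sub h4).sub_const _)

theorem abs_chordCoord_le {q : ℂ × Circ} (hq : q.1 ∈ disc) : |chordCoord q| ≤ chordHalf q := by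
  have : ‖q.1‖ ≤ 1 := by simpa [disc] using hq
  exact Real.abs_le_sqrt (by nlinarith [norm_nonneg q.1])

theorem chordHalf_sq {q : ℂ × Circ} (hq : q.1 ∈ disc) :
    chordHalf q ^ 2 = chordCoord q ^ 2 + 1 - ‖q.1‖ ^ 2 := by
  have : ‖q.1‖ ≤ 1 := by simpa [disc] using hq
  exact Real.sq_sqrt (by nlinarith [norm_nonneg q.1, sq_nonneg (chordCoord q)])

theorem dir_arg {c : ℂ} (hc : ‖c‖ = 1) : dir ((Complex.arg c : ℝ) : Circ) = c := by
  rw [dir_coe]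
  simpa [hc] using Complex.norm_mul_exp_arg_mul_I c

theorem norm_entry_base {q : ℂ × Circ} (hq : q.1 ∈ disc) :
    ‖q.1 - backTime q * dir q.2‖ = 1 := by
  have h1 : ‖q.1 - backTime q * dir q.2‖ ^ 2 = 1 := by
    have hn : (dir q.2).re ^ 2 + (dir q.2).im ^ 2 = 1 := by
      have := dir_norm q.2
      rw [← sq_eq_sq₀ (norm_nonneg _) zero_le_one, ← Complex.normSq_eq_norm_sq,
        Complex.normSq_apply] at this
      linarith
    have h2 := chordHalf_sq hq
    rw [← Complex.normSq_eq_norm_sq, Complex.normSq_apply] at h2 ⊢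
    have h3 : chordCoord q = q.1.re * (dir q.2).re + q.1.im * (dir q.2).im := by
      simp [chordCoord]
    simp only [backTime_eq, Complex.sub_re, Complex.sub_im, Complex.mul_re, Complex.mul_im,
      Complex.ofReal_re, Complex.ofReal_im]
    set b := chordHalf q
    set s := chordCoord q
    linear_combination h2 + (s + b) ^ 2 * hn + 2 * (s + b) * h3
  exact (pow_eq_one_iff_of_nonneg (norm_nonneg _) two_ne_zero).mp h1

theorem ccos_entry {q : ℂ × Circ} (hq : q.1 ∈ disc) : ccos (entry q).2 = chordHalf q := by
  have h1 := dir_arg (norm_entry_base hq)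
  set β : Circ := ((Complex.arg (q.1 - backTime q * dir q.2) : ℝ) : Circ) with hβ
  have h2 : dir (entry q).2 * dir β = -dir q.2 := by
    have : entry q = (β, q.2 - β - piC) := rfl
    rw [this, ← dir_add]
    have h3 : q.2 - β - piC + β + piC = q.2 := by abel
    have h4 := dir_add (q.2 - β - piC + β) piC
    rw [h3, dir_piC] at h4
    rw [h4]; ring
  have h3 : dir (entry q).2 = -(dir q.2 * (starRingEnd ℂ) (dir β)) := by
    linear_combination (starRingEnd ℂ) (dir β) * h2 - dir (entry q).2 * dir_conj β
  rw [ccos, h3, h1, map_sub, map_mul, Complex.conj_ofReal]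
  have h4 : -(dir q.2 * ((starRingEnd ℂ) q.1 - backTime q * (starRingEnd ℂ) (dir q.2))) =
      backTime q - dir q.2 * (starRingEnd ℂ) q.1 := by
    linear_combination (backTime q : ℂ) * dir_conj q.2
  rw [h4, backTime_eq, Complex.sub_re, Complex.ofReal_re]
  have h5 : (dir q.2 * (starRingEnd ℂ) q.1).re = chordCoord q := by
    simp [chordCoord]; ring
  rw [h5]; ring

theorem entry_mem_inflow {q : ℂ × Circ} (hq : q.1 ∈ disc) : entry q ∈ inflow := by
  show 0 ≤ ccos (entry q).2
  rw [ccos_entry hq]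
  exact Real.sqrt_nonneg _

theorem backTime_mem {q : ℂ × Circ} (hq : q.1 ∈ disc) :
    backTime q ∈ Icc 0 (2 * ccos (entry q).2) := by
  have := abs_le.mp (abs_chordCoord_le hq)
  rw [ccos_entry hq, backTime_eq]
  constructor <;> linarith [this.1, this.2]

theorem flow_entry {q : ℂ × Circ} (hq : q.1 ∈ disc) : flow (entry q) (backTime q) = q := by
  have h1 := dir_arg (norm_entry_base hq)
  set β : Circ := ((Complex.arg (q.1 - backTime q * dir q.2) : ℝ) : Circ) with hβ
  have h2 : entry q = (β, q.2 - β - piC) := rfl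
  have h3 : β + piC + (q.2 - β - piC) = q.2 := by abel
  rw [h2, flow]
  simp only [h3]
  refine Prod.ext ?_ rfl
  simp only
  rw [h1]; ring

theorem flow_mem_disc {p : Circ × Circ} {t : ℝ} (ht : t ∈ Icc 0 (2 * ccos p.2)) :
    (flow p t).1 ∈ disc := by
  have hb := dir_conj p.1
  have ha := dir_conj p.2
  have e1 : dir (p.1 + piC + p.2) = -(dir p.1 * dir p.2) := by
    rw [dir_add, dir_add, dir_piC]; ring
  have e2 : (flow p t).1 = dir p.1 * (1 - t * dir p.2) := by
    simp only [flow]; rw [e1]; ring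
  have h1 : (dir p.2).re ^ 2 + (dir p.2).im ^ 2 = 1 := by
    have := dir_norm p.2
    rw [← sq_eq_sq₀ (norm_nonneg _) zero_le_one, ← Complex.normSq_eq_norm_sq,
      Complex.normSq_apply] at this
    linarith
  rw [disc, mem_closedBall_zero_iff, e2, norm_mul, dir_norm, one_mul,
    ← sq_le_one_iff₀ (norm_nonneg _), ← Complex.normSq_eq_norm_sq, Complex.normSq_apply]
  have h2 : t ≤ 2 * (dir p.2).re := ht.2
  have h3 : (1 - (t : ℂ) * dir p.2).re = 1 - t * (dir p.2).re := by simp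
  have h4 : (1 - (t : ℂ) * dir p.2).im = -(t * (dir p.2).im) := by simp
  rw [h3, h4]
  have h5 := mul_nonneg ht.1 (sub_nonneg.mpr h2)
  have h6 : t ^ 2 * ((dir p.2).re ^ 2 + (dir p.2).im ^ 2) = t ^ 2 := by rw [h1, mul_one]
  linarith [show (1 - t * (dir p.2).re) * (1 - t * (dir p.2).re) +
    -(t * (dir p.2).im) * -(t * (dir p.2).im) = 1 - 2 * t * (dir p.2).re +
    t ^ 2 * ((dir p.2).re ^ 2 + (dir p.2).im ^ 2) by ring,
    show t * (2 * (dir p.2).re - t) = 2 * t * (dir p.2).re - t ^ 2 by ring]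

/-! ### Null sets and square integrability along geodesics -/

/-- Santaló's formula is applied to a measurable null set containing the exceptions. The weight cos
α can be discarded where it is positive; where it is zero the time interval is a single point. -/
theorem ae_flow_of_ae {P : ℂ × Circ → Prop} (h : ∀ᵐ q ∂measSM, P q) :
    ∀ᵐ p ∂measInflow, ∀ᵐ t ∂(volume.restrict (Icc 0 (2 * ccos p.2))), P (flow p t) := by
  obtain ⟨N, hsub, hN, hN0⟩ := exists_measurable_superset_of_null h
  have h1 := santalo (N.indicator 1) (measurable_const.indicator hN)
  rw [lintegral_indicator_one hN, hN0] at h1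
  have hm1 : Measurable fun x : (Circ × Circ) × ℝ =>
      (N.indicator 1 (flow x.1 x.2) : ℝ≥0∞) * ENNReal.ofReal (ccos x.1.2) := by
    refine ((measurable_const.indicator hN).comp continuous_flow.measurable).mul
      (ENNReal.measurable_ofReal.comp (continuous_ccos.measurable.comp (by fun_prop)))
  have hm2 : Measurable fun p : Circ × Circ => ∫⁻ t in Icc 0 (2 * ccos p.2),
      (N.indicator 1 (flow p t) : ℝ≥0∞) * ENNReal.ofReal (ccos p.2) := by
    have hs : MeasurableSet {y : (Circ × Circ) × ℝ | y.2 ∈ Icc 0 (2 * ccos y.1.2)} :=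
      (measurableSet_le measurable_const measurable_snd).inter
        (measurableSet_le measurable_snd
          ((continuous_ccos.measurable.comp (by fun_prop)).const_mul 2))
    have := ((hm1.indicator hs).lintegral_prod_right' (ν := (volume : Measure ℝ)))
    convert! this using 2 with x
    rw [← lintegral_indicator measurableSet_Icc]
    rfl
  have h2 := (lintegral_eq_zero_iff hm2).mp h1.symm
  filter_upwards [h2, ae_restrict_mem measurableSet_inflow] with p hp hpin
  rcases eq_or_lt_of_le (show 0 ≤ ccos p.2 from hpin) with hc | hc
  · rw [← hc]
    simp
  · have hmp : Measurable fun t : ℝ =>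
        (N.indicator 1 (flow p t) : ℝ≥0∞) * ENNReal.ofReal (ccos p.2) :=
      hm1.comp (f := fun t : ℝ => (p, t)) (by fun_prop)
    rw [Pi.zero_apply, lintegral_eq_zero_iff hmp] at hp
    filter_upwards [hp] with t ht
    by_contra hP
    have hmem : flow p t ∈ N := hsub hP
    simp [hmem] at ht
    exact absurd ht hc.not_ge

/-- A geodesic of length 2 cos α carries the weight cos α, and 2 cos² α ≤ 2. This makes h ↦ h_ψ well
defined on classes and bounded in L². -/
theorem map_entry_le : Measure.map entry measSM ≤ (2 : ℝ≥0∞) • measBdry := by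
  refine Measure.le_iff.mpr fun s hs => ?_
  rw [Measure.map_apply measurable_entry hs, ← lintegral_indicator_one (measurable_entry hs),
    santalo _ (measurable_one.indicator (measurable_entry hs))]
  calc ∫⁻ p, (∫⁻ t in Icc 0 (2 * ccos p.2),
        (entry ⁻¹' s).indicator 1 (flow p t) * ENNReal.ofReal (ccos p.2)) ∂measInflow
      ≤ ∫⁻ p, 2 * s.indicator 1 p ∂measInflow := by
        refine lintegral_mono_ae ?_
        filter_upwards [ae_restrict_mem measurableSet_inflow] with p hp
        have hc1 : ccos p.2 ≤ 1 := by
          have := Complex.re_le_norm (dir p.2)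
          rwa [dir_norm] at this
        have h1 : ∫⁻ t in Icc 0 (2 * ccos p.2),
            (entry ⁻¹' s).indicator 1 (flow p t) * ENNReal.ofReal (ccos p.2) ≤
            ∫⁻ t in Icc 0 (2 * ccos p.2), s.indicator 1 p := by
          refine setLIntegral_mono' measurableSet_Icc fun t ht => ?_
          have h2 : (entry ⁻¹' s).indicator (1 : ℂ × Circ → ℝ≥0∞) (flow p t) = s.indicator 1 p := by
            have h3 : flow p t ∈ entry ⁻¹' s ↔ p ∈ s := by rw [mem_preimage, entry_flow hp ht]
            by_cases hps : p ∈ s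
            · rw [indicator_of_mem hps, indicator_of_mem (h3.mpr hps)]; rfl
            · rw [indicator_of_notMem hps, indicator_of_notMem (fun h => hps (h3.mp h))]
          rw [h2]
          calc _ ≤ s.indicator 1 p * (1 : ℝ≥0∞) := by
                gcongr
                simpa using hc1
            _ = _ := mul_one _
        refine h1.trans ?_
        rw [setLIntegral_const, mul_comm, Real.volume_Icc]
        gcongr
        rw [sub_zero, ← ENNReal.ofReal_ofNat]
        exact ENNReal.ofReal_le_ofReal (by linarith)
    _ ≤ ∫⁻ p, 2 * s.indicator 1 p ∂measBdry := lintegral_mono' Measure.restrict_le_self le_rfl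
    _ = ((2 : ℝ≥0∞) • measBdry) s := by
        rw [lintegral_const_mul _ (measurable_one.indicator hs), lintegral_indicator_one hs]
        rfl

theorem quasiMeasurePreserving_entry : Measure.QuasiMeasurePreserving entry measSM measBdry :=
  ⟨measurable_entry, (Measure.absolutelyContinuous_of_le map_entry_le).trans
    (Measure.smul_absolutelyContinuous)⟩

theorem memLp_invExt {h : Circ × Circ → ℂ} (hh : MemLp h 2 measBdry) :
    MemLp (invExt h) 2 measSM := by
  have h1 : MemLp h 2 (Measure.map entry measSM) :=
    hh.of_measure_le_smul (by norm_num) map_entry_le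
  exact (memLp_map_measure_iff h1.1 measurable_entry.aemeasurable).mp h1

theorem eLpNorm_invExt_le {h : Circ × Circ → ℂ} (hh : MemLp h 2 measBdry) :
    eLpNorm (invExt h) 2 measSM ≤ 2 * eLpNorm h 2 measBdry := by
  have h1 : MemLp h 2 (Measure.map entry measSM) :=
    hh.of_measure_le_smul (by norm_num) map_entry_le
  calc eLpNorm (invExt h) 2 measSM = eLpNorm h 2 (Measure.map entry measSM) :=
        (eLpNorm_map_measure h1.1 measurable_entry.aemeasurable).symm
    _ ≤ eLpNorm h 2 ((2 : ℝ≥0∞) • measBdry) := eLpNorm_mono_measure _ map_entry_le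
    _ = (2 : ℝ≥0∞) ^ (1 / (2 : ℝ≥0∞)).toReal • eLpNorm h 2 measBdry :=
        eLpNorm_smul_measure_of_ne_top (p := 2) (by norm_num) _ _
    _ ≤ 2 * eLpNorm h 2 measBdry := by
        rw [smul_eq_mul]
        gcongr
        calc (2 : ℝ≥0∞) ^ (1 / (2 : ℝ≥0∞)).toReal ≤ 2 ^ (1 : ℝ) :=
              ENNReal.rpow_le_rpow_of_exponent_le (by norm_num) (by simp; norm_num)
          _ = 2 := ENNReal.rpow_one 2

/-! ### The scattering relations -/

/-- With the coordinates swapped this is a skew product: a reflection of α, and a translation of β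
by an amount depending on α. -/
theorem measurePreserving_scat : MeasurePreserving scat measBdry measBdry := by
  have h1 : MeasurePreserving (fun p : Circ × Circ => (piC - p.1, p.2 + (piC + 2 • p.1)))
      ((volume : Measure Circ).prod volume) ((volume : Measure Circ).prod volume) :=
    (Measure.measurePreserving_sub_left volume piC).skew_product
      (g := fun a b => b + (piC + 2 • a)) (by unfold Function.uncurry; fun_prop)
      (Filter.Eventually.of_forall fun a => (measurePreserving_add_right volume _).map_eq)
  have h2 := (Measure.measurePreserving_swap (μ := (volume : Measure Circ))
    (ν := (volume : Measure Circ))).comp (h1.comp (Measure.measurePreserving_swap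
      (μ := (volume : Measure Circ)) (ν := (volume : Measure Circ))))
  convert! h2 using 1
  ext p <;> simp [scat, add_assoc]

theorem measurePreserving_scatA : MeasurePreserving scatA measBdry measBdry := by
  have h2 := (measurePreserving_fiberShift (ν := (volume : Measure Circ))).comp
    measurePreserving_scat
  convert! h2 using 1
  ext p
  · simp [scat, scatA]
  · have hpp : piC + piC = 0 := by
      rw [piC, ← AddCircle.coe_add, ← two_mul, AddCircle.coe_period]
    simp only [scat, scatA, Function.comp]
    calc -p.2 = -p.2 + (piC + piC) := by rw [hpp, add_zero]
      _ = _ := by abel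

/-! ### Polynomial solutions of the transport equation -/

/-- The function `z ^ b * conj z ^ c * e^{ikθ}` on `SM`. -/
noncomputable def trigMonomial (b c : ℕ) (k : ℤ) (q : ℂ × Circ) : ℂ :=
  q.1 ^ b * conj q.1 ^ c * fourier k q.2

/-- The trigonometric polynomials in `θ` with frequencies in `K` and coefficients polynomial
in `z` and `conj z`. -/
noncomputable def trigSpace (K : Set ℤ) : Submodule ℂ (ℂ × Circ → ℂ) :=
  Submodule.span ℂ {V | ∃ b c : ℕ, ∃ k ∈ K, V = trigMonomial b c k}

theorem trigMonomial_mem {K : Set ℤ} (b c : ℕ) {k : ℤ} (hk : k ∈ K) :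
    trigMonomial b c k ∈ trigSpace K := Submodule.subset_span ⟨b, c, k, hk, rfl⟩

/-- `X V = f`, for a function `f` of all of `SM`. -/
def HasGeodDeriv (V f : ℂ × Circ → ℂ) : Prop :=
  ∀ z θ, HasLineDerivAt ℝ (fun z => V (z, θ)) (f (z, θ)) z (dir θ)

theorem HasGeodDeriv.add {V W f g : ℂ × Circ → ℂ} (hV : HasGeodDeriv V f)
    (hW : HasGeodDeriv W g) : HasGeodDeriv (V + W) (f + g) :=
  fun z θ => HasDerivAt.add (hV z θ) (hW z θ)

theorem HasGeodDeriv.sub {V W f g : ℂ × Circ → ℂ} (hV : HasGeodDeriv V f)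
    (hW : HasGeodDeriv W g) : HasGeodDeriv (V - W) (f - g) :=
  fun z θ => HasDerivAt.sub (hV z θ) (hW z θ)

theorem HasGeodDeriv.smul {V f : ℂ × Circ → ℂ} (c : ℂ) (hV : HasGeodDeriv V f) :
    HasGeodDeriv (c • V) (c • f) :=
  fun z θ => HasDerivAt.const_smul c (hV z θ)

theorem HasGeodDeriv.sum {ι : Type*} {s : Finset ι} {V f : ι → ℂ × Circ → ℂ}
    (h : ∀ i ∈ s, HasGeodDeriv (V i) (f i)) :
    HasGeodDeriv (∑ i ∈ s, V i) (∑ i ∈ s, f i) := by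
  classical
  induction s using Finset.induction_on with
  | empty => exact fun z θ => hasDerivAt_const _ _
  | insert i s hi ih =>
    rw [Finset.sum_insert hi, Finset.sum_insert hi]
    exact (h i (Finset.mem_insert_self i s)).add
      (ih fun j hj => h j (Finset.mem_insert_of_mem hj))

theorem dir_ne_zero (θ : Circ) : dir θ ≠ 0 := by
  rw [← norm_pos_iff, dir_norm]; exact one_pos

theorem conj_dir (θ : Circ) : conj (dir θ) = (dir θ)⁻¹ :=
  eq_inv_of_mul_eq_one_right (dir_conj θ)

/-- X = e^{iθ}∂_z + e^{-iθ}∂_{z̄}: differentiating in z raises the frequency by one, differentiating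
in z̄ lowers it. The truncated exponents at b = 0 or c = 0 come with the coefficient zero. -/
theorem hasGeodDeriv_trigMonomial (b c : ℕ) (k : ℤ) :
    HasGeodDeriv (trigMonomial b c k)
      ((b : ℂ) • trigMonomial (b - 1) c (k + 1) + (c : ℂ) • trigMonomial b (c - 1) (k - 1)) := by
  intro z θ
  have h1 : HasDerivAt (fun t : ℝ => z + t • dir θ) (dir θ) 0 := by
    simpa using ((hasDerivAt_id (0 : ℝ)).smul_const (dir θ)).const_add z
  have h2 : HasDerivAt (fun t : ℝ => conj (z + t • dir θ)) (conj (dir θ)) 0 :=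
    (Complex.conjCLE.toContinuousLinearMap.hasFDerivAt.comp_hasDerivAt (0 : ℝ) h1 :)
  have h3 := ((h1.pow b).mul (h2.pow c)).mul_const (fourier k θ : ℂ)
  refine HasDerivAt.congr_deriv h3 ?_
  have he := dir_ne_zero θ
  simp only [zero_smul, add_zero, Pi.add_apply, Pi.smul_apply, trigMonomial, smul_eq_mul,
    fourier_eq_zpow, zpow_add_one₀ he, zpow_sub_one₀ he, conj_dir, Pi.pow_apply]
  ring

/-- The quantity `2 i Im (z e^{-iθ})`, constant along geodesics. -/
noncomputable def angMom (q : ℂ × Circ) : ℂ := q.1 * fourier (-1) q.2 - conj q.1 * fourier 1 q.2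

/-- The functions `e^{imθ} σ ^ q`, with `σ = angMom`, constant along geodesics. -/
noncomputable def ridge (m : ℤ) (q : ℕ) (x : ℂ × Circ) : ℂ := fourier m x.2 * angMom x ^ q

theorem hasGeodDeriv_ridge (m : ℤ) (q : ℕ) : HasGeodDeriv (ridge m q) 0 := by
  intro z θ
  have : (fun t : ℝ => ridge m q (z + t • dir θ, θ)) = fun _ => ridge m q (z, θ) := by
    funext t
    have he := dir_ne_zero θ
    simp only [ridge, angMom, fourier_eq_zpow, map_add, Complex.real_smul, map_mul,
      Complex.conj_ofReal, conj_dir, zpow_neg, zpow_one]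
    congr 2
    field_simp
    ring
  rw [HasLineDerivAt, this]
  exact hasDerivAt_const _ _

theorem ridge_eq_sum (m : ℤ) (q : ℕ) : ridge m q = ∑ i ∈ Finset.range (q + 1),
    ((-1) ^ i * (q.choose i : ℂ)) • trigMonomial (q - i) i (m + 2 * i - q) := by
  funext x
  have he := dir_ne_zero x.2
  rw [ridge, angMom, sub_eq_neg_add, add_pow, Finset.mul_sum, Finset.sum_apply]
  refine Finset.sum_congr rfl fun i hi => ?_
  have hi' : i ≤ q := Nat.lt_succ_iff.mp (Finset.mem_range.mp hi)
  have h1 : (m + 2 * i - q : ℤ) = m + i + -((q - i : ℕ) : ℤ) := by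
    rw [Nat.cast_sub hi']; ring
  simp only [Pi.smul_apply, trigMonomial, smul_eq_mul, fourier_eq_zpow, h1, zpow_add₀ he,
    zpow_neg, zpow_natCast, zpow_one, mul_pow, neg_pow (conj x.1 * dir x.2), inv_pow]
  ring

theorem ridge_mem {K : Set ℤ} {m : ℤ} {q : ℕ} (h : ∀ i : ℕ, i ≤ q → m + 2 * i - q ∈ K) :
    ridge m q ∈ trigSpace K := by
  rw [ridge_eq_sum]
  exact Submodule.sum_mem _ fun i hi => Submodule.smul_mem _ _
    (trigMonomial_mem _ _ (h i (Nat.lt_succ_iff.mp (Finset.mem_range.mp hi))))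

/-- Odd positive frequencies. -/
def oddPos : Set ℤ := {k | Odd k ∧ 0 < k}

/-- Odd negative frequencies. -/
def oddNeg : Set ℤ := {k | Odd k ∧ k < 0}

/-- `W` splits into parts of odd positive and odd negative frequencies that solve the transport
equation with right-hand sides `-a` and `a`. -/
def SplitsWith (W : ℂ × Circ → ℂ) (a : ℂ → ℂ) : Prop :=
  ∃ V ∈ trigSpace oddPos, ∃ V' ∈ trigSpace oddNeg, V + V' = W ∧
    HasGeodDeriv V (fun q => -a q.1) ∧ HasGeodDeriv V' (fun q => a q.1)

theorem SplitsWith.sum {ι : Type*} {s : Finset ι} {W : ι → ℂ × Circ → ℂ} {a : ι → ℂ → ℂ}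
    (c : ι → ℂ) (h : ∀ i ∈ s, SplitsWith (W i) (a i)) :
    SplitsWith (∑ i ∈ s, c i • W i) (∑ i ∈ s, c i • a i) := by
  choose! V hV V' hV' hs hd hd' using h
  refine ⟨∑ i ∈ s, c i • V i, Submodule.sum_mem _ fun i hi => Submodule.smul_mem _ _ (hV i hi),
    ∑ i ∈ s, c i • V' i, Submodule.sum_mem _ fun i hi => Submodule.smul_mem _ _ (hV' i hi),
    ?_, ?_, ?_⟩
  · rw [← Finset.sum_add_distrib]
    exact Finset.sum_congr rfl fun i hi => by rw [← smul_add, hs i hi]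
  · convert! HasGeodDeriv.sum fun i hi => (hd i hi).smul (c i) using 1
    funext q
    simp [Finset.sum_apply]
  · convert! HasGeodDeriv.sum fun i hi => (hd' i hi).smul (c i) using 1
    funext q
    simp [Finset.sum_apply]

/-- All frequencies are odd and lie between m - q and m + q, so for q ≤ |m| they have a single sign
and one of the two halves is zero. -/
theorem splitsWith_ridge_of_le {m : ℤ} {q : ℕ} (hodd : Odd (m + q)) (hq : (q : ℤ) ≤ |m|) :
    SplitsWith (ridge m q) 0 := by
  have h0 : (fun q : ℂ × Circ => -(0 : ℂ → ℂ) q.1) = 0 := by funext q; simp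
  have hz : HasGeodDeriv (0 : ℂ × Circ → ℂ) 0 := fun z θ => hasDerivAt_const _ _
  rcases le_total 0 m with hm | hm
  · rw [abs_of_nonneg hm] at hq
    refine ⟨ridge m q, ridge_mem fun i hi => ?_, 0, Submodule.zero_mem _, add_zero _, ?_, hz⟩
    · obtain ⟨k, hk⟩ := hodd
      exact ⟨⟨k + i - q, by omega⟩, by omega⟩
    · rw [h0]; exact hasGeodDeriv_ridge m q
  · rw [abs_of_nonpos hm] at hq
    refine ⟨0, Submodule.zero_mem _, ridge m q, ridge_mem fun i hi => ?_, zero_add _, ?_,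
      hasGeodDeriv_ridge m q⟩
    · obtain ⟨k, hk⟩ := hodd
      exact ⟨⟨k + i - q, by omega⟩, by omega⟩
    · rw [h0]; exact hz

/-- The frequencies run through the odd numbers from -2l - 1 to 2j + 1, and the cut is between -1
and 1. Since X kills the whole sum, the derivative of either half reduces to what crosses the cut, a
term of frequency 0. -/
theorem splitsWith_ridge (j l : ℕ) :
    SplitsWith (ridge ((j : ℤ) - l) (j + l + 1)) (fun z =>
      ((-1) ^ l * ((l : ℂ) + 1) * ((j + l + 1).choose (l + 1) : ℂ)) * (z ^ j * conj z ^ l)) := by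
  set q := j + l + 1 with hq
  set m : ℤ := (j : ℤ) - l with hm
  set V := ∑ s ∈ Finset.range (j + 1), ((-1) ^ (l + 1 + s) * (q.choose (l + 1 + s) : ℂ)) •
    trigMonomial (j - s) (l + 1 + s) (2 * s + 1) with hV
  set V' := ∑ i ∈ Finset.range (l + 1), ((-1) ^ i * (q.choose i : ℂ)) •
    trigMonomial (q - i) i (m + 2 * i - q) with hV'
  have hsum : V + V' = ridge m q := by
    rw [ridge_eq_sum, show q + 1 = (l + 1) + (j + 1) by omega, Finset.sum_range_add, add_comm]
    congr 1
    refine Finset.sum_congr rfl fun s hs => ?_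
    congr 2
    · omega
    · push_cast; omega
  have hd : HasGeodDeriv V (fun x => -((-1) ^ l * ((l : ℂ) + 1) *
      ((j + l + 1).choose (l + 1) : ℂ) * (x.1 ^ j * conj x.1 ^ l))) := by
    -- `h s` is the frequency 2s term obtained by lowering the s-th summand; raising the previous
    -- summand gives its negative, so the derivative telescopes.
    let h : ℕ → ℂ × Circ → ℂ := fun s => ((-1) ^ (l + 1 + s) * (q.choose (l + 1 + s) : ℂ) *
      (l + 1 + s : ℕ)) • trigMonomial (j - s) (l + s) (2 * s)
    have h1 := HasGeodDeriv.sum (s := Finset.range (j + 1)) fun s _ =>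
      (hasGeodDeriv_trigMonomial (j - s) (l + 1 + s) (2 * s + 1)).smul
        ((-1) ^ (l + 1 + s) * (q.choose (l + 1 + s) : ℂ))
    have h2 : ∀ s ∈ Finset.range (j + 1), ((-1) ^ (l + 1 + s) * (q.choose (l + 1 + s) : ℂ)) •
        (((j - s : ℕ) : ℂ) • trigMonomial (j - s - 1) (l + 1 + s) (2 * s + 1 + 1) +
        ((l + 1 + s : ℕ) : ℂ) • trigMonomial (j - s) (l + 1 + s - 1) (2 * s + 1 - 1)) =
        h s - h (s + 1) := by
      intro s hs
      have hs' := Finset.mem_range.mp hs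
      have e1 : (q.choose (l + 1 + s) : ℂ) * (j - s : ℕ) =
          (q.choose (l + 1 + (s + 1)) : ℂ) * (l + 1 + (s + 1) : ℕ) := by
        have := Nat.choose_succ_right_eq q (l + 1 + s)
        rw [show q - (l + 1 + s) = j - s by omega] at this
        exact_mod_cast this.symm
      simp only [h]
      rw [show l + 1 + s - 1 = l + s by omega, show (2 * (s : ℤ) + 1 - 1) = 2 * s by ring,
        show j - s - 1 = j - (s + 1) by omega, show l + 1 + s = l + (s + 1) by omega,
        show (2 * ((s + 1 : ℕ) : ℤ)) = 2 * s + 1 + 1 by push_cast; ring, smul_add, smul_smul,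
        smul_smul, add_comm, ← sub_neg_eq_add, ← neg_smul]
      congr 2
      rw [show l + (s + 1) = l + 1 + s by omega, mul_assoc, e1, show l + 1 + (s + 1) = l + 1 + s + 1 by omega, pow_succ]
      ring
    rw [Finset.sum_congr rfl h2, Finset.sum_range_sub'] at h1
    convert! h1 using 1
    funext x
    simp only [h, Pi.sub_apply, Pi.smul_apply, trigMonomial]
    -- The upper end of the telescoping sum carries the binomial coefficient of q + 1 out of q.
    rw [Nat.choose_eq_zero_of_lt (show q < l + 1 + (j + 1) by omega)]
    simp
    rw [pow_succ]
    ring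
  refine ⟨V, ?_, V', ?_, hsum, hd, ?_⟩
  · exact Submodule.sum_mem _ fun s _ => Submodule.smul_mem _ _
      (trigMonomial_mem _ _ ⟨⟨s, rfl⟩, by positivity⟩)
  · refine Submodule.sum_mem _ fun i hi => Submodule.smul_mem _ _ (trigMonomial_mem _ _ ?_)
    have := Finset.mem_range.mp hi
    exact ⟨⟨i - l - 1, by omega⟩, by omega⟩
  · have : V' = ridge m q - V := by rw [← hsum, add_sub_cancel_left]
    rw [this]
    convert! (hasGeodDeriv_ridge m q).sub hd using 1
    funext x
    simp only [Pi.sub_apply, Pi.zero_apply, zero_sub, neg_neg]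
    rfl

/-- Power sums of two numbers of product `-1` as polynomials in their sum. -/
theorem exists_powerSum (q : ℕ) : ∃ c : ℕ → ℂ, (0 < q → c 0 = 1) ∧ (∀ r, q < 2 * r → c r = 0) ∧
    ∀ x y : ℂ, x * y = -1 →
      x ^ q + y ^ q = ∑ r ∈ Finset.range (q + 1), c r * (x + y) ^ (q - 2 * r) := by
  induction q using Nat.strong_induction_on with
  | _ q ih =>
    match q, ih with
    | 0, _ =>
      -- For exponent zero the power sum is 2, which is why the normalization `c 0 = 1` is only
      -- claimed for positive q.
      refine ⟨fun r => if r = 0 then 2 else 0, by simp, fun r hr => by simp; omega, ?_⟩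
      intro x y _
      simp
      norm_num
    | 1, _ =>
      refine ⟨fun r => if r = 0 then 1 else 0, by simp, fun r hr => by simp; omega, ?_⟩
      intro x y _
      simp
    | q + 2, ih =>
      obtain ⟨c, hc0, hcz, hc⟩ := ih (q + 1) (by omega)
      obtain ⟨d, -, hdz, hd⟩ := ih q (by omega)
      refine ⟨fun r => c r + if r = 0 then 0 else d (r - 1), ?_, ?_, ?_⟩
      · intro _; simp [hc0]
      · intro r hr
        have h1 : r ≠ 0 := by omega
        simp [h1, hcz r (by omega), hdz (r - 1) (by omega)]
      · intro x y hxy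
        -- Newton's recurrence for power sums; the sign of the last term comes from xy = -1.
        have h1 : x ^ (q + 2) + y ^ (q + 2) =
            (x + y) * (x ^ (q + 1) + y ^ (q + 1)) + (x ^ q + y ^ q) := by
          linear_combination -(x ^ q + y ^ q) * hxy
        rw [h1, hc x y hxy, hd x y hxy, Finset.mul_sum]
        simp only [add_mul (c _), Finset.sum_add_distrib]
        congr 1
        · rw [Finset.sum_range_succ (fun r => c r * (x + y) ^ (q + 2 - 2 * r)) (q + 2),
            hcz (q + 2) (by omega), zero_mul, add_zero]
          refine Finset.sum_congr rfl fun r _ => ?_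
          by_cases hr : 2 * r ≤ q + 1
          · rw [show q + 2 - 2 * r = q + 1 - 2 * r + 1 by omega]
            ring
          · rw [hcz r (by omega)]; ring
        · rw [Finset.sum_range_succ' _ (q + 2), Finset.sum_range_succ _ (q + 1)]
          simp only [Nat.add_eq_zero_iff, one_ne_zero, and_false, if_false, if_true, zero_mul,
            add_zero, Nat.add_sub_cancel]
          rw [hdz (q + 1) (by omega), zero_mul, add_zero]
          refine Finset.sum_congr rfl fun r _ => ?_
          rw [show q + 2 - 2 * (r + 1) = q - 2 * r by omega]

/-! ### Boundary values -/

/-- The boundary point of `SM` with given fan-beam coordinates. -/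
noncomputable def bdryPt (p : Circ × Circ) : ℂ × Circ := (dir p.1, p.1 + piC + p.2)

theorem flow_zero (p : Circ × Circ) : flow p 0 = bdryPt p := by simp [flow, bdryPt]

theorem flow_exit (p : Circ × Circ) : flow p (2 * ccos p.2) = bdryPt (scat p) := flow_end p

theorem piC_add_piC : piC + piC = 0 := by
  rw [piC, ← AddCircle.coe_add, ← two_mul, AddCircle.coe_period]

theorem bdryPt_scat_snd (p : Circ × Circ) : (bdryPt (scat p)).2 = (bdryPt p).2 := by
  simp only [bdryPt, scat, two_smul]
  calc p.1 + piC + (p.2 + p.2) + piC + (piC - p.2) = p.1 + piC + p.2 + (piC + piC) := by abel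
    _ = _ := by rw [piC_add_piC, add_zero]

theorem scat_scat (p : Circ × Circ) : scat (scat p) = p := by
  refine Prod.ext ?_ ?_
  · simp only [scat, two_smul]
    calc p.1 + piC + (p.2 + p.2) + piC + (piC - p.2 + (piC - p.2))
        = p.1 + (piC + piC) + (piC + piC) := by abel
      _ = p.1 := by rw [piC_add_piC, add_zero, add_zero]
  · simp [scat]

theorem dir_bdryPt_snd (p : Circ × Circ) : dir (bdryPt p).2 = -(dir p.1 * dir p.2) := by
  rw [bdryPt, dir_add, dir_add, dir_piC]; ring

/-- On the boundary σ is the sum of two numbers of product -1, which the scattering relation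
exchanges (`dir_scat_snd`). -/
theorem angMom_bdryPt (p : Circ × Circ) :
    angMom (bdryPt p) = -(dir p.2)⁻¹ + dir p.2 := by
  have h1 := dir_ne_zero p.1
  have h2 := dir_ne_zero p.2
  rw [angMom, fourier_eq_zpow, fourier_eq_zpow, dir_bdryPt_snd]
  simp only [bdryPt, zpow_neg, zpow_one, conj_dir]
  field_simp
  ring

theorem dir_scat_snd (p : Circ × Circ) : dir (scat p).2 = -(dir p.2)⁻¹ := by
  have h2 := dir_ne_zero p.2
  have h := dir_add (piC - p.2) p.2
  rw [sub_add_cancel, dir_piC] at h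
  simp only [scat]
  field_simp
  exact h.symm

/-- For fixed β the angle θ is a translate of α, so the frequencies in α stay in `K`. -/
theorem exists_span_fourier {K : Set ℤ} {V : ℂ × Circ → ℂ} (hV : V ∈ trigSpace K) (β : Circ) :
    ∃ f ∈ Submodule.span ℂ ((fun k => (fourier k : C(Circ, ℂ))) '' K),
      ∀ α, V (bdryPt (β, α)) = f α := by
  induction hV using Submodule.span_induction with
  | mem V hV =>
    obtain ⟨b, c, k, hk, rfl⟩ := hV
    refine ⟨(dir β ^ b * conj (dir β) ^ c * fourier k (β + piC) : ℂ) • fourier k,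
      Submodule.smul_mem _ _ (Submodule.subset_span ⟨k, hk, rfl⟩), fun α => ?_⟩
    simp only [trigMonomial, bdryPt, ContinuousMap.smul_apply, smul_eq_mul, fourier_eq_zpow,
      dir_add _ α, mul_zpow]
    ring
  | zero => exact ⟨0, Submodule.zero_mem _, fun α => rfl⟩
  | add V W _ _ hV hW =>
    obtain ⟨f, hf, hf'⟩ := hV
    obtain ⟨g, hg, hg'⟩ := hW
    exact ⟨f + g, Submodule.add_mem _ hf hg, fun α => by simp [hf', hg']⟩
  | smul c V _ hV =>
    obtain ⟨f, hf, hf'⟩ := hV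
    exact ⟨c • f, Submodule.smul_mem _ _ hf, fun α => by simp [hf']⟩

theorem linearIndependent_fourier :
    LinearIndependent ℂ (fun k : ℤ => (fourier k : C(Circ, ℂ))) := by
  have h := (orthonormal_fourier (T := 2 * π)).linearIndependent
  exact LinearIndependent.of_comp
    (ContinuousMap.toLp (E := ℂ) 2 AddCircle.haarAddCircle ℂ).toLinearMap h

/-- A polynomial solution `V` with odd positive frequencies of `X V = -a`, together with a solution
`V'` with odd negative frequencies of `X V' = a` such that `V + V'` is constant along geodesics and
each of the two gives the boundary values of the other at the opposite end point. -/
structure TransportPair (a : ℂ → ℂ) (V V' : ℂ × Circ → ℂ) : Prop where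
  pos : V ∈ trigSpace oddPos
  neg : V' ∈ trigSpace oddNeg
  deriv : HasGeodDeriv V fun q => -a q.1
  deriv' : HasGeodDeriv V' fun q => a q.1
  bdry : ∀ p, V' (bdryPt p) = V (bdryPt (scat p))

/-- As a function of α, the sum of the boundary values contains only the frequencies m + q > 0 and m
- q < 0, so the first term must be V and the second V'. The scattering relation exchanges the two
terms, as it preserves θ. -/
theorem bdry_of_sum {V V' : ℂ × Circ → ℂ} (hV : V ∈ trigSpace oddPos)
    (hV' : V' ∈ trigSpace oddNeg) {m : ℤ} {q : ℕ} (h1 : m + q ∈ oddPos) (h2 : m - q ∈ oddNeg)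
    (h : ∀ p, (V + V') (bdryPt p) =
      fourier m (bdryPt p).2 * ((-(dir p.2)⁻¹) ^ q + dir p.2 ^ q)) (p : Circ × Circ) :
    V' (bdryPt p) = V (bdryPt (scat p)) := by
  have hdis : Disjoint oddPos oddNeg := by
    rw [Set.disjoint_left]
    intro k hk hk'
    exact lt_asymm hk.2 hk'.2
  have key : ∀ p : Circ × Circ, V (bdryPt p) = fourier m (bdryPt p).2 * dir p.2 ^ q := by
    rintro ⟨β, α⟩
    obtain ⟨f, hf, hf'⟩ := exists_span_fourier hV β
    obtain ⟨g, hg, hg'⟩ := exists_span_fourier hV' β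
    set c : ℂ := fourier m (β + piC)
    have e : ∀ x : Circ, fourier m (bdryPt (β, x)).2 = c * dir x ^ m := fun x => by
      simp only [bdryPt, c, fourier_eq_zpow, dir_add _ x, mul_zpow]
    -- A combination of positive frequencies equals one of negative frequencies, so both vanish by
    -- linear independence.
    have hsum : f - c • fourier (m + q) = -(g - (c * (-1) ^ q) • fourier (m - q)) := by
      ext x
      have hx := dir_ne_zero x
      have := h (β, x)
      rw [Pi.add_apply, hf', hg', e] at this
      simp only [ContinuousMap.sub_apply, ContinuousMap.smul_apply, ContinuousMap.neg_apply,
        fourier_eq_zpow, smul_eq_mul, zpow_add₀ hx, zpow_sub₀ hx, zpow_natCast]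
      rw [neg_pow, inv_pow] at this
      linear_combination this
    have hz : f - c • fourier (m + q) = 0 := by
      refine Submodule.disjoint_def.mp
        (linearIndependent_fourier.disjoint_span_image hdis) _ ?_ ?_
      · exact Submodule.sub_mem _ hf (Submodule.smul_mem _ _ (Submodule.subset_span ⟨_, h1, rfl⟩))
      · rw [hsum]
        exact Submodule.neg_mem _ (Submodule.sub_mem _ hg
          (Submodule.smul_mem _ _ (Submodule.subset_span ⟨_, h2, rfl⟩)))
    rw [hf', sub_eq_zero.mp hz, e]
    simp [fourier_eq_zpow, zpow_add₀ (dir_ne_zero α), -fourier_apply, mul_assoc]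
  have h3 := h p
  rw [Pi.add_apply, key p] at h3
  rw [key, bdryPt_scat_snd, dir_scat_snd]
  linear_combination h3

/-- The right-hand sides for which there is a `TransportPair`. -/
noncomputable def pairSpace : Submodule ℂ (ℂ → ℂ) where
  carrier := {a | ∃ V V', TransportPair a V V'}
  zero_mem' := by
    have hz : HasGeodDeriv (0 : ℂ × Circ → ℂ) 0 := fun z θ => hasDerivAt_const _ _
    refine ⟨0, 0, Submodule.zero_mem _, Submodule.zero_mem _, ?_, ?_, fun p => rfl⟩
    · convert! hz using 1; funext q; simp
    · exact hz
  add_mem' := by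
    rintro a b ⟨V, V', h⟩ ⟨W, W', h'⟩
    refine ⟨V + W, V' + W', Submodule.add_mem _ h.pos h'.pos, Submodule.add_mem _ h.neg h'.neg,
      ?_, h.deriv'.add h'.deriv', fun p => by simp [h.bdry, h'.bdry]⟩
    convert! h.deriv.add h'.deriv using 1
    funext q; simp [add_comm]
  smul_mem' := by
    rintro c a ⟨V, V', h⟩
    refine ⟨c • V, c • V', Submodule.smul_mem _ _ h.pos, Submodule.smul_mem _ _ h.neg,
      ?_, h.deriv'.smul c, fun p => by simp [h.bdry]⟩
    convert! h.deriv.smul c using 1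
    funext q; simp

theorem monomial_mem_pairSpace (l : ℕ) : ∀ j : ℕ, (fun z : ℂ => z ^ j * conj z ^ l) ∈ pairSpace := by
  induction l using Nat.strong_induction_on with
  | _ l ih =>
    intro j
    set q := j + l + 1 with hq
    set m : ℤ := (j : ℤ) - l with hm
    obtain ⟨c, hc0, hcz, hc⟩ := exists_powerSum q
    -- The r-th function of the combination contributes a multiple of z^{j-r} z̄^{l-r}: the target
    -- for r = 0, and for r > 0 either covered by the induction hypothesis or zero.
    have step : ∀ r : ℕ, ∃ a : ℂ → ℂ, (2 * r ≤ q → SplitsWith (ridge m (q - 2 * r)) a) ∧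
        (0 < r → a ∈ pairSpace) ∧ (r = 0 → a = fun z =>
          ((-1) ^ l * ((l : ℂ) + 1) * ((j + l + 1).choose (l + 1) : ℂ)) * (z ^ j * conj z ^ l)) := by
      intro r
      rcases Nat.eq_zero_or_pos r with rfl | hr
      · exact ⟨_, fun _ => splitsWith_ridge j l, fun h => absurd h (lt_irrefl 0), fun _ => rfl⟩
      by_cases hjl : r ≤ j ∧ r ≤ l
      · have h1 := splitsWith_ridge (j - r) (l - r)
        rw [show j - r + (l - r) + 1 = q - 2 * r by omega,
          show ((j - r : ℕ) : ℤ) - ((l - r : ℕ) : ℤ) = m by omega] at h1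
        refine ⟨_, fun _ => h1, fun _ => ?_, fun h => absurd h hr.ne'⟩
        exact pairSpace.smul_mem _ (ih (l - r) (by omega) (j - r))
      -- Here r > min(j, l), whence q - 2r ≤ |j - l| = |m|.
      · refine ⟨0, fun h2 => splitsWith_ridge_of_le ⟨j - r, by omega⟩ ?_,
          fun _ => pairSpace.zero_mem, fun h => absurd h hr.ne'⟩
        rcases abs_cases m with h | h <;> omega
    choose a ha ha' ha0 using step
    have hsplit := SplitsWith.sum (s := (Finset.range (q + 1)).filter fun r => 2 * r ≤ q)
      (W := fun r => ridge m (q - 2 * r)) (a := a) c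
      (fun r hr => ha r (Finset.mem_filter.mp hr).2)
    -- Terms with 2r > q, where the exponent q - 2r is truncated, have coefficient zero.
    have hfilter : ∀ {M : Type} [AddCommGroup M] [Module ℂ M] (f : ℕ → M),
        ∑ r ∈ (Finset.range (q + 1)).filter (fun r => 2 * r ≤ q), c r • f r =
        ∑ r ∈ Finset.range (q + 1), c r • f r := by
      intro M _ _ f
      refine Finset.sum_filter_of_ne fun r _ hne => ?_
      by_contra hlt
      exact hne (by rw [hcz r (by omega), zero_smul])
    rw [hfilter, hfilter] at hsplit
    have hmem : ∑ r ∈ Finset.range (q + 1), c r • a r ∈ pairSpace := by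
      obtain ⟨V, hV, V', hV', hs, hd, hd'⟩ := hsplit
      refine ⟨V, V', hV, hV', hd, hd', bdry_of_sum hV hV' (m := m) (q := q)
        ⟨⟨j, by omega⟩, by omega⟩ ⟨⟨-l - 1, by omega⟩, by omega⟩ fun p => ?_⟩
      have hp : -(dir p.2)⁻¹ * dir p.2 = -1 := by
        rw [neg_mul, inv_mul_cancel₀ (dir_ne_zero _)]
      rw [hs, hc _ _ hp, Finset.sum_apply, Finset.mul_sum]
      refine Finset.sum_congr rfl fun r _ => ?_
      rw [Pi.smul_apply, ridge, angMom_bdryPt, smul_eq_mul]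
      ring
    -- The r = 0 term has coefficient 1 and is a nonzero multiple of the target monomial; all other
    -- terms are already known to lie in the space.
    rw [Finset.sum_range_succ', hc0 (by omega), one_smul, ha0 0 rfl] at hmem
    have h2 := (Submodule.add_mem_iff_right _ (Submodule.sum_mem _ fun r _ =>
      Submodule.smul_mem _ _ (ha' (r + 1) (Nat.succ_pos r)))).mp hmem
    have hne : ((-1) ^ l * ((l : ℂ) + 1) * ((j + l + 1).choose (l + 1) : ℂ)) ≠ 0 := by
      refine mul_ne_zero (mul_ne_zero (pow_ne_zero _ (by norm_num)) (Nat.cast_add_one_ne_zero l)) ?_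
      exact_mod_cast (Nat.choose_pos (by omega)).ne'
    exact (Submodule.smul_mem_iff _ hne).mp h2

/-! ### Continuous functions on the disc and their X-ray transforms -/

instance compactSpace_disc : CompactSpace disc :=
  isCompact_iff_compactSpace.mp (isCompact_closedBall (0 : ℂ) 1)

/-- The radial retraction of the plane onto the closed disc. -/
noncomputable def retract (z : ℂ) : ℂ := z / (max 1 ‖z‖ : ℝ)

theorem retract_mem (z : ℂ) : retract z ∈ disc := by
  rw [disc, mem_closedBall_zero_iff, retract, norm_div, Complex.norm_real, Real.norm_eq_abs,
    abs_of_pos (lt_max_of_lt_left one_pos)]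
  exact div_le_one_of_le₀ (le_max_right _ _) (le_trans zero_le_one (le_max_left _ _))

theorem retract_of_mem {z : ℂ} (hz : z ∈ disc) : retract z = z := by
  have : ‖z‖ ≤ 1 := by simpa [disc] using hz
  simp [retract, max_eq_left this]

theorem continuous_retract : Continuous retract := by
  unfold retract
  refine continuous_id.div (by fun_prop) fun z => ?_
  exact_mod_cast (lt_max_of_lt_left one_pos : (0 : ℝ) < max 1 ‖z‖).ne'

/-- The continuous extension to the plane of a continuous function on the disc. -/
noncomputable def extend : C(disc, ℂ) →ₗ[ℂ] (ℂ → ℂ) where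
  toFun f z := f ⟨retract z, retract_mem z⟩
  map_add' _ _ := rfl
  map_smul' _ _ := rfl

theorem continuous_extend (f : C(disc, ℂ)) : Continuous (extend f) :=
  f.continuous.comp (continuous_retract.subtype_mk _)

theorem norm_extend_le (f : C(disc, ℂ)) (z : ℂ) : ‖extend f z‖ ≤ ‖f‖ := f.norm_coe_le_norm _

theorem extend_of_mem (f : C(disc, ℂ)) {z : ℂ} (hz : z ∈ disc) : extend f z = f ⟨z, hz⟩ := by
  show f _ = f _
  congr 2
  exact retract_of_mem hz

theorem intervalIntegrable_extend (f : C(disc, ℂ)) {γ : ℝ → ℂ} (hγ : Continuous γ) (s t : ℝ) :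
    IntervalIntegrable (fun r => extend f (γ r)) volume s t :=
  ((continuous_extend f).comp hγ).intervalIntegrable s t

theorem continuous_flow_fst (p : Circ × Circ) : Continuous fun t => (flow p t).1 :=
  continuous_fst.comp (continuous_flow.comp (by fun_prop : Continuous fun t : ℝ => (p, t)))

theorem continuous_xray (f : C(disc, ℂ)) : Continuous (xray (extend f)) := by
  refine intervalIntegral.continuous_parametric_intervalIntegral_of_continuous
    (f := fun (p : Circ × Circ) t => extend f (flow p t).1) ?_
    ((continuous_ccos.comp continuous_snd).const_mul 2)
  exact (continuous_extend f).comp (continuous_fst.comp continuous_flow)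

theorem abs_ccos_le (α : Circ) : |ccos α| ≤ 1 := by
  have := Complex.abs_re_le_norm (dir α)
  rwa [dir_norm] at this

theorem norm_xray_le (f : C(disc, ℂ)) (p : Circ × Circ) : ‖xray (extend f) p‖ ≤ 2 * ‖f‖ := by
  have h := intervalIntegral.norm_integral_le_of_norm_le_const (a := 0) (b := 2 * ccos p.2)
    (f := fun t => extend f (flow p t).1) (C := ‖f‖) fun t _ => norm_extend_le f _
  refine h.trans ?_
  rw [sub_zero, abs_mul, abs_two, mul_comm]
  have := mul_le_mul_of_nonneg_right (abs_ccos_le p.2) (norm_nonneg f)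
  linarith

/-- The function `A₋ I₀ f`. -/
noncomputable def oddData : C(disc, ℂ) →ₗ[ℂ] (Circ × Circ → ℂ) where
  toFun f := extA (-1) (xray (extend f))
  map_add' f g := by
    have h : ∀ p, xray (extend (f + g)) p = xray (extend f) p + xray (extend g) p := fun p => by
      rw [xray, xray, xray, ← intervalIntegral.integral_add
        (intervalIntegrable_extend f (continuous_flow_fst p) _ _)
        (intervalIntegrable_extend g (continuous_flow_fst p) _ _), map_add]
      rfl
    funext p
    simp only [extA, Pi.add_apply, h]
    split_ifs <;> ring
  map_smul' c f := by
    have h : ∀ p, xray (extend (c • f)) p = c * xray (extend f) p := fun p => by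
      rw [xray, xray, ← intervalIntegral.integral_const_mul, map_smul]
      rfl
    funext p
    simp only [extA, Pi.smul_apply, h, smul_eq_mul, RingHom.id_apply]
    split_ifs <;> ring

theorem measurable_oddData (f : C(disc, ℂ)) : Measurable (oddData f) := by
  classical
  have hx := (continuous_xray f).measurable
  exact Measurable.ite measurableSet_inflow hx
    ((hx.comp measurePreserving_scat.measurable).const_mul _)

theorem norm_oddData_le (f : C(disc, ℂ)) (p : Circ × Circ) : ‖oddData f p‖ ≤ 2 * ‖f‖ := by
  show ‖extA (-1) (xray (extend f)) p‖ ≤ _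
  rw [extA]
  split_ifs
  · exact norm_xray_le f p
  · simpa using norm_xray_le f (scat p)

/-- Half of the integral of `sgn(t) f` along the geodesic `t ↦ x + t e^{iθ}`. -/
noncomputable def signedRay : C(disc, ℂ) →ₗ[ℂ] (ℂ × Circ → ℂ) where
  toFun f q := (1 / 2) * ((∫ t in (0 : ℝ)..(chordHalf q - chordCoord q),
    extend f (q.1 + t * dir q.2)) - ∫ t in (0 : ℝ)..backTime q, extend f (q.1 - t * dir q.2))
  map_add' f g := by
    funext q
    have h1 : Continuous fun t : ℝ => q.1 + t * dir q.2 := by fun_prop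
    have h2 : Continuous fun t : ℝ => q.1 - t * dir q.2 := by fun_prop
    simp only [map_add, Pi.add_apply]
    rw [intervalIntegral.integral_add (intervalIntegrable_extend f h1 _ _)
      (intervalIntegrable_extend g h1 _ _), intervalIntegral.integral_add
      (intervalIntegrable_extend f h2 _ _) (intervalIntegrable_extend g h2 _ _)]
    ring
  map_smul' c f := by
    funext q
    simp only [map_smul, Pi.smul_apply, smul_eq_mul, intervalIntegral.integral_const_mul,
      RingHom.id_apply]
    ring

theorem continuous_signedRay (f : C(disc, ℂ)) : Continuous (signedRay f) := by
  have hd := continuous_dir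
  have hf := continuous_extend f
  refine continuous_const.mul (Continuous.sub ?_ ?_)
  · exact intervalIntegral.continuous_parametric_intervalIntegral_of_continuous
      (f := fun (q : ℂ × Circ) (t : ℝ) => extend f (q.1 + t * dir q.2)) (by fun_prop)
      (continuous_chordHalf.sub continuous_chordCoord)
  · exact intervalIntegral.continuous_parametric_intervalIntegral_of_continuous
      (f := fun (q : ℂ × Circ) (t : ℝ) => extend f (q.1 - t * dir q.2)) (by fun_prop)
      continuous_backTime

theorem chordHalf_le_one {q : ℂ × Circ} (hq : q.1 ∈ disc) : chordHalf q ≤ 1 := by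
  rw [← ccos_entry hq]
  exact (abs_le.mp (abs_ccos_le _)).2

theorem norm_signedRay_le (f : C(disc, ℂ)) {q : ℂ × Circ} (hq : q.1 ∈ disc) :
    ‖signedRay f q‖ ≤ 2 * ‖f‖ := by
  have h1 := intervalIntegral.norm_integral_le_of_norm_le_const (a := 0)
    (b := chordHalf q - chordCoord q)
    (f := fun t : ℝ => extend f (q.1 + t * dir q.2)) (C := ‖f‖) fun t _ => norm_extend_le f _
  have h2 := intervalIntegral.norm_integral_le_of_norm_le_const (a := 0) (b := backTime q)
    (f := fun t : ℝ => extend f (q.1 - t * dir q.2)) (C := ‖f‖) fun t _ => norm_extend_le f _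
  have h3 := chordHalf_le_one hq
  have h4 := abs_le.mp (abs_chordCoord_le hq)
  have h5 : |chordHalf q - chordCoord q - 0| ≤ 2 := by
    rw [abs_le]; constructor <;> linarith [h4.1, h4.2]
  have h6 : |backTime q - 0| ≤ 2 := by
    rw [abs_le, backTime_eq]; constructor <;> linarith [h4.1, h4.2]
  show ‖(1 / 2 : ℂ) * (_ - _)‖ ≤ _
  rw [norm_mul]
  have h7 := norm_sub_le (∫ t in (0 : ℝ)..(chordHalf q - chordCoord q),
    extend f (q.1 + t * dir q.2)) (∫ t in (0 : ℝ)..backTime q, extend f (q.1 - t * dir q.2))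
  have h8 := mul_le_mul_of_nonneg_left h5 (norm_nonneg f)
  have h9 := mul_le_mul_of_nonneg_left h6 (norm_nonneg f)
  have h10 : ‖(1 / 2 : ℂ)‖ = 1 / 2 := by norm_num
  rw [h10]
  linarith

theorem chordCoord_flow (p : Circ × Circ) (t : ℝ) : chordCoord (flow p t) = t - ccos p.2 := by
  have hb := dir_conj p.1
  have ha := dir_conj p.2
  have e1 : dir (p.1 + piC + p.2) = -(dir p.1 * dir p.2) := by
    rw [dir_add, dir_add, dir_piC]; ring
  have e2 : (flow p t).1 * conj (dir (flow p t).2) = t - conj (dir p.2) := by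
    simp only [flow]
    rw [e1, map_neg, map_mul]
    linear_combination (-conj (dir p.2) + t * (dir p.2 * conj (dir p.2))) * hb + t * ha
  rw [chordCoord, e2]
  simp [ccos]

theorem chordHalf_flow {p : Circ × Circ} (hp : p ∈ inflow) {t : ℝ}
    (ht : t ∈ Icc 0 (2 * ccos p.2)) : chordHalf (flow p t) = ccos p.2 := by
  rw [← ccos_entry (flow_mem_disc ht), entry_flow hp ht]

/-- From time t the geodesic extends by t backward and by 2 cos α - t forward; half the difference
of the two integrals is half the total minus what has been traversed. This is the explicit function
behind the boundary traces. -/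
theorem signedRay_flow (f : C(disc, ℂ)) {p : Circ × Circ} (hp : p ∈ inflow) {t : ℝ}
    (ht : t ∈ Icc 0 (2 * ccos p.2)) : signedRay f (flow p t) =
      (1 / 2) * xray (extend f) p - ∫ s in (0 : ℝ)..t, extend f (flow p s).1 := by
  have h1 := chordHalf_flow hp ht
  have h2 := chordCoord_flow p t
  have h3 : ∀ s : ℝ, (flow p t).1 + s * dir (flow p t).2 = (flow p (t + s)).1 := fun s => by
    simp only [flow]; push_cast; ring
  have h4 : ∀ s : ℝ, (flow p t).1 - s * dir (flow p t).2 = (flow p (t - s)).1 := fun s => by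
    simp only [flow]; push_cast; ring
  show (1 / 2 : ℂ) * (_ - _) = _
  rw [backTime_eq, h1, h2]
  simp_rw [h3, h4]
  rw [intervalIntegral.integral_comp_add_left (fun s => extend f (flow p s).1),
    intervalIntegral.integral_comp_sub_left (fun s => extend f (flow p s).1), xray,
    ← intervalIntegral.integral_add_adjacent_intervals (b := t)
      (intervalIntegrable_extend f (continuous_flow_fst p) 0 t)
      (intervalIntegrable_extend f (continuous_flow_fst p) t (2 * ccos p.2))]
  rw [show t + (ccos p.2 - (t - ccos p.2)) = 2 * ccos p.2 by ring,
    show t - (t - ccos p.2 + ccos p.2) = 0 by ring, add_zero, sub_zero]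
  ring

/-! ### Bounded operators -/

section Bounded

variable {X : Type*} [MeasurableSpace X] {μ : Measure X} [IsFiniteMeasure μ]

theorem memLp_of_linear_bound {Φ : C(disc, ℂ) →ₗ[ℂ] (X → ℂ)}
    (hm : ∀ f, AEStronglyMeasurable (Φ f) μ) {C : ℝ} (hb : ∀ f, ∀ᵐ x ∂μ, ‖Φ f x‖ ≤ C * ‖f‖)
    (f : C(disc, ℂ)) : MemLp (Φ f) 2 μ := MemLp.of_bound (hm f) _ (hb f)

/-- The bounded operator into `L²` given by a family of bounded functions. -/
noncomputable def boundedToLp (Φ : C(disc, ℂ) →ₗ[ℂ] (X → ℂ))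
    (hm : ∀ f, AEStronglyMeasurable (Φ f) μ) (C : ℝ) (hC : 0 ≤ C)
    (hb : ∀ f, ∀ᵐ x ∂μ, ‖Φ f x‖ ≤ C * ‖f‖) : C(disc, ℂ) →L[ℂ] Lp ℂ 2 μ :=
  LinearMap.mkContinuous
    { toFun := fun f => (memLp_of_linear_bound hm hb f).toLp (Φ f)
      map_add' := fun f g => by
        rw [← MemLp.toLp_add]
        exact MemLp.toLp_congr _ _ (Filter.Eventually.of_forall fun x => by rw [map_add])
      map_smul' := fun c f => by
        rw [RingHom.id_apply, ← MemLp.toLp_const_smul]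
        exact MemLp.toLp_congr _ _ (Filter.Eventually.of_forall fun x => by rw [map_smul]) }
    (measureUnivNNReal μ ^ (2 : ℝ≥0∞).toReal⁻¹ * C) fun f => by
      rw [mul_assoc]
      refine Lp.norm_le_of_ae_bound (mul_nonneg hC (norm_nonneg f)) ?_
      filter_upwards [hb f, (memLp_of_linear_bound hm hb f).coeFn_toLp] with x h1 h2
      simp only [LinearMap.coe_mk, AddHom.coe_mk]
      rwa [h2]

theorem coeFn_boundedToLp (Φ : C(disc, ℂ) →ₗ[ℂ] (X → ℂ))
    (hm : ∀ f, AEStronglyMeasurable (Φ f) μ) (C : ℝ) (hC : 0 ≤ C)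
    (hb : ∀ f, ∀ᵐ x ∂μ, ‖Φ f x‖ ≤ C * ‖f‖) (f : C(disc, ℂ)) :
    boundedToLp Φ hm C hC hb f =ᵐ[μ] Φ f := (memLp_of_linear_bound hm hb f).coeFn_toLp

end Bounded

theorem ae_mem_disc : ∀ᵐ q ∂((volume.restrict disc).prod (volume : Measure Circ)), q.1 ∈ disc :=
  Measure.quasiMeasurePreserving_fst.ae (ae_restrict_mem measurable_disc)

/-- `f ↦ A₋ I₀ f` as an operator into `L²(∂SM)`. -/
noncomputable def oddDataLp : C(disc, ℂ) →L[ℂ] L2 (volume : Measure Circ) :=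
  boundedToLp oddData (fun f => (measurable_oddData f).aestronglyMeasurable) 2 zero_le_two
    fun f => Filter.Eventually.of_forall (norm_oddData_le f)

/-- `signedRay` as an operator into `L²(SM)`. -/
noncomputable def signedRayLp : C(disc, ℂ) →L[ℂ] L2 (volume.restrict disc) :=
  boundedToLp signedRay (fun f => (continuous_signedRay f).aestronglyMeasurable) 2 zero_le_two
    fun f => ae_mem_disc.mono fun _ hq => norm_signedRay_le f hq

theorem coeFn_oddDataLp (f : C(disc, ℂ)) : oddDataLp f =ᵐ[measBdry] oddData f :=
  coeFn_boundedToLp (μ := (volume : Measure Circ).prod (volume : Measure Circ)) _ _ _ _ _ f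

theorem coeFn_signedRayLp (f : C(disc, ℂ)) : signedRayLp f =ᵐ[measSM] signedRay f :=
  coeFn_boundedToLp (μ := (volume.restrict disc).prod (volume : Measure Circ)) _ _ _ _ _ f

/-- The pull-back of functions on the disc to `SM`. -/
noncomputable def pullback : C(disc, ℂ) →ₗ[ℂ] (ℂ × Circ → ℂ) where
  toFun f q := extend f q.1
  map_add' f g := by funext q; simp
  map_smul' c f := by funext q; simp

/-- The pull-back of functions on the disc, as an operator into `L²(SM)`. -/
noncomputable def pullbackLp : C(disc, ℂ) →L[ℂ] L2 (volume.restrict disc) :=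
  boundedToLp pullback
    (fun f => ((continuous_extend f).comp continuous_fst).aestronglyMeasurable) 1 zero_le_one
    fun f => Filter.Eventually.of_forall fun q => by rw [one_mul]; exact norm_extend_le f _

theorem coeFn_pullbackLp (f : C(disc, ℂ)) : pullbackLp f =ᵐ[measSM] fun q => extend f q.1 :=
  coeFn_boundedToLp (μ := (volume.restrict disc).prod (volume : Measure Circ)) _ _ _ _ _ f

theorem memLp_invExt_coe (u : L2 (volume : Measure Circ)) :
    MemLp (invExt u) 2 ((volume.restrict disc).prod (volume : Measure Circ)) :=
  memLp_invExt (Lp.memLp u)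

/-- `h ↦ h_ψ` as an operator from `L²(∂SM)` to `L²(SM)`. -/
noncomputable def invExtLp : L2 (volume : Measure Circ) →L[ℂ] L2 (volume.restrict disc) :=
  LinearMap.mkContinuous
    { toFun := fun u => (memLp_invExt_coe u).toLp (invExt u)
      map_add' := fun u v => by
        rw [← MemLp.toLp_add]
        refine MemLp.toLp_congr _ _ ?_
        exact quasiMeasurePreserving_entry.ae (Lp.coeFn_add u v)
      map_smul' := fun c u => by
        rw [RingHom.id_apply, ← MemLp.toLp_const_smul]
        refine MemLp.toLp_congr _ _ ?_
        exact quasiMeasurePreserving_entry.ae (Lp.coeFn_smul c u) }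
    2 fun u => by
      simp only [LinearMap.coe_mk, AddHom.coe_mk]
      rw [Lp.norm_toLp, Lp.norm_def]
      have h := eLpNorm_invExt_le (Lp.memLp u)
      have h2 := ENNReal.toReal_mono
        (ENNReal.mul_ne_top ENNReal.ofNat_ne_top (Lp.eLpNorm_ne_top u)) h
      rwa [ENNReal.toReal_mul, ENNReal.toReal_ofNat] at h2

theorem coeFn_invExtLp (u : L2 (volume : Measure Circ)) : invExtLp u =ᵐ[measSM] invExt u :=
  (memLp_invExt_coe u).coeFn_toLp

theorem invExt_congr {g h : Circ × Circ → ℂ} (e : g =ᵐ[measBdry] h) :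
    invExt g =ᵐ[measSM] invExt h := quasiMeasurePreserving_entry.ae e

/-- Composition with the scattering relation on `L²(∂SM)`. -/
noncomputable def scatLp : L2 (volume : Measure Circ) →L[ℂ] L2 (volume : Measure Circ) :=
  (Lp.compMeasurePreservingₗᵢ ℂ scat measurePreserving_scat).toContinuousLinearMap

theorem coeFn_scatLp (u : L2 (volume : Measure Circ)) :
    scatLp u =ᵐ[measBdry] fun p => u (scat p) :=
  Lp.coeFn_compMeasurePreserving u measurePreserving_scat

/-- The operator `A₊^* H₋ / 8π` on `L²(∂SM)`. -/
noncomputable def halfInverse : L2 (volume : Measure Circ) →L[ℂ] L2 (volume : Measure Circ) :=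
  (1 / (8 * π) : ℂ) • ((ContinuousLinearMap.id ℂ _ + scatLp).comp
    (hilbertLp volume {k | Odd k}))

/-- `f ↦ n_ψ` as an operator into `L²(SM)`. -/
noncomputable def invariantLp : C(disc, ℂ) →L[ℂ] L2 (volume.restrict disc) :=
  (invExtLp.comp halfInverse).comp oddDataLp

/-- The Hilbert transform of `n_ψ`. -/
noncomputable def hilbertInvariantLp : C(disc, ℂ) →L[ℂ] L2 (volume.restrict disc) :=
  (hilbertLp (volume.restrict disc) univ).comp invariantLp

/-- The operator `f ↦ w_f`. -/
noncomputable def solutionLp : C(disc, ℂ) →L[ℂ] L2 (volume.restrict disc) :=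
  (2 * π * Complex.I) • (invariantLp + Complex.I • hilbertInvariantLp)

/-! ### Operators on trigonometric polynomials -/

theorem norm_trigMonomial_le (b c : ℕ) (k : ℤ) {q : ℂ × Circ} (hq : q.1 ∈ disc) :
    ‖trigMonomial b c k q‖ ≤ 1 := by
  have : ‖q.1‖ ≤ 1 := by simpa [disc] using hq
  rw [trigMonomial, norm_mul, norm_mul, norm_pow, norm_pow, RCLike.norm_conj, norm_fourier_apply,
    mul_one]
  exact mul_le_one₀ (pow_le_one₀ (norm_nonneg _) this) (by positivity)
    (pow_le_one₀ (norm_nonneg _) this)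

theorem continuous_trigMonomial (b c : ℕ) (k : ℤ) : Continuous (trigMonomial b c k) := by
  have := (fourier k : C(Circ, ℂ)).continuous
  unfold trigMonomial
  exact ((continuous_fst.pow b).mul ((Complex.continuous_conj.comp continuous_fst).pow c)).mul
    (this.comp continuous_snd)

theorem continuous_of_mem_trigSpace {K : Set ℤ} {V : ℂ × Circ → ℂ} (hV : V ∈ trigSpace K) :
    Continuous V := by
  induction hV using Submodule.span_induction with
  | mem V hV =>
    obtain ⟨b, c, k, -, rfl⟩ := hV
    exact continuous_trigMonomial b c k
  | zero => exact continuous_const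
  | add V W _ _ hV hW => exact hV.add hW
  | smul c V _ hV => exact hV.const_smul c

/-- Treats SM (with Ψ the identity) and ∂SM (with Ψ = `bdryPt`) together. -/
theorem exists_memLp_mem_harmonicSpace {Y : Type*} [MeasurableSpace Y] {ν : Measure Y}
    (Ψ : Y × Circ → ℂ × Circ) {K : Set ℤ}
    (h : ∀ b c : ℕ, ∀ k ∈ K, MemLp (trigMonomial b c k ∘ Ψ) 2 (ν.prod (volume : Measure Circ)) ∧
      ∃ f : Y → ℂ, ∀ p, trigMonomial b c k (Ψ p) = f p.1 * fourier k p.2)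
    {V : ℂ × Circ → ℂ} (hV : V ∈ trigSpace K) :
    ∃ hm : MemLp (V ∘ Ψ) 2 (ν.prod (volume : Measure Circ)),
      hm.toLp (V ∘ Ψ) ∈ harmonicSpace ν K := by
  induction hV using Submodule.span_induction with
  | mem V hV =>
    obtain ⟨b, c, k, hk, rfl⟩ := hV
    obtain ⟨hm, f, hf⟩ := h b c k hk
    exact ⟨hm, harm_mem ν hk _ f (hm.coeFn_toLp.trans (Filter.Eventually.of_forall hf))⟩
  | zero => exact ⟨MemLp.zero, by convert! Submodule.zero_mem _⟩
  | add V W _ _ hV hW =>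
    obtain ⟨h1, h1'⟩ := hV
    obtain ⟨h2, h2'⟩ := hW
    exact ⟨h1.add h2, Submodule.add_mem _ h1' h2'⟩
  | smul c V _ hV =>
    obtain ⟨h1, h1'⟩ := hV
    exact ⟨h1.const_smul c, Submodule.smul_mem _ c h1'⟩

theorem trigSpace_SM {K : Set ℤ} {V : ℂ × Circ → ℂ} (hV : V ∈ trigSpace K) :
    ∃ hm : MemLp V 2 ((volume.restrict disc).prod (volume : Measure Circ)),
      hm.toLp V ∈ harmonicSpace (volume.restrict disc) K :=
  exists_memLp_mem_harmonicSpace id (fun b c k _ =>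
    ⟨MemLp.of_bound (continuous_trigMonomial b c k).aestronglyMeasurable 1
      (ae_mem_disc.mono fun _ hq => norm_trigMonomial_le b c k hq),
    fun z => z ^ b * conj z ^ c, fun _ => rfl⟩) hV

theorem continuous_bdryPt : Continuous bdryPt := by
  have := continuous_dir
  unfold bdryPt
  fun_prop

theorem bdryPt_fst_mem (p : Circ × Circ) : (bdryPt p).1 ∈ disc := by
  simp [bdryPt, disc, dir_norm]

theorem trigSpace_bdry {K : Set ℤ} {V : ℂ × Circ → ℂ} (hV : V ∈ trigSpace K) :
    ∃ hm : MemLp (V ∘ bdryPt) 2 ((volume : Measure Circ).prod (volume : Measure Circ)),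
      hm.toLp (V ∘ bdryPt) ∈ harmonicSpace (volume : Measure Circ) K :=
  exists_memLp_mem_harmonicSpace bdryPt (fun b c k _ =>
    ⟨MemLp.of_bound ((continuous_trigMonomial b c k).comp continuous_bdryPt).aestronglyMeasurable 1
      (Filter.Eventually.of_forall fun p => norm_trigMonomial_le b c k (bdryPt_fst_mem p)),
    fun β => dir β ^ b * conj (dir β) ^ c * fourier k (β + piC), fun p => by
      simp only [trigMonomial, bdryPt, fourier_eq_zpow, dir_add _ p.2, mul_zpow]
      ring⟩) hV

/-! ### The operators on polynomial data -/

theorem mem_inflow_or_scat (p : Circ × Circ) : p ∈ inflow ∨ scat p ∈ inflow := by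
  by_cases hp : p ∈ inflow
  · exact Or.inl hp
  · right
    have h1 : ¬ 0 ≤ (dir p.2).re := hp
    show 0 ≤ (dir (scat p).2).re
    rw [dir_scat_snd, ← conj_dir]
    simp only [Complex.neg_re, Complex.conj_re]
    linarith

theorem HasGeodDeriv.hasDerivAt_flow {V f : ℂ × Circ → ℂ} (h : HasGeodDeriv V f)
    (p : Circ × Circ) (t : ℝ) : HasDerivAt (fun s => V (flow p s)) (f (flow p t)) t := by
  have h1 : HasDerivAt (fun s : ℝ => V ((flow p t).1 + s • dir (flow p t).2, (flow p t).2))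
      (f (flow p t)) (t - t) := by
    rw [sub_self]
    exact h (flow p t).1 (flow p t).2
  have h2 := HasDerivAt.scomp (h := fun s => s - t) t h1 ((hasDerivAt_id t).sub_const t)
  rw [one_smul] at h2
  refine h2.congr_of_eventuallyEq (Filter.Eventually.of_forall fun s => ?_)
  simp only [Function.comp, flow, Complex.real_smul]
  congr 2
  push_cast
  ring

namespace TransportPair

variable {a : ℂ → ℂ} {V V' : ℂ × Circ → ℂ} {f : C(disc, ℂ)}

theorem integral_eq (h : TransportPair a V V') (hf : ∀ z ∈ disc, extend f z = a z)
    {p : Circ × Circ} {t : ℝ} (ht : t ∈ Icc 0 (2 * ccos p.2)) :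
    ∫ s in (0 : ℝ)..t, extend f (flow p s).1 = V (flow p 0) - V (flow p t) := by
  have h1 : ∫ s in (0 : ℝ)..t, -extend f (flow p s).1 = V (flow p t) - V (flow p 0) := by
    refine intervalIntegral.integral_eq_sub_of_hasDerivAt (f := fun s => V (flow p s))
      (f' := fun s => -extend f (flow p s).1) (fun s hs => ?_)
      (intervalIntegrable_extend f (continuous_flow_fst p) 0 t).neg
    rw [uIcc_of_le ht.1] at hs
    rw [hf _ (flow_mem_disc ⟨hs.1, hs.2.trans ht.2⟩)]
    exact h.deriv.hasDerivAt_flow p s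
  rw [intervalIntegral.integral_neg] at h1
  linear_combination -h1

theorem add_flow (h : TransportPair a V V') (p : Circ × Circ) (t : ℝ) :
    V (flow p t) + V' (flow p t) = V (bdryPt p) + V' (bdryPt p) := by
  have h1 : ∀ s, HasDerivAt (fun s => V (flow p s) + V' (flow p s)) 0 s := fun s => by
    simpa using (h.deriv.hasDerivAt_flow p s).fun_add (h.deriv'.hasDerivAt_flow p s)
  have h2 := is_const_of_deriv_eq_zero (fun s => (h1 s).differentiableAt)
    (fun s => (h1 s).deriv) t 0
  rwa [flow_zero] at h2

/-- The integral is V at the entrance minus V at the exit, and the latter is V' at the entrance. -/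
theorem xray_eq (h : TransportPair a V V') (hf : ∀ z ∈ disc, extend f z = a z)
    {p : Circ × Circ} (hp : p ∈ inflow) :
    xray (extend f) p = V (bdryPt p) - V' (bdryPt p) := by
  have hp' : 0 ≤ ccos p.2 := hp
  rw [xray, h.integral_eq hf ⟨by positivity, le_rfl⟩, flow_zero, flow_exit, h.bdry]

theorem oddData_eq (h : TransportPair a V V') (hf : ∀ z ∈ disc, extend f z = a z) :
    oddData f = V ∘ bdryPt - V' ∘ bdryPt := by
  funext p
  show extA (-1) (xray (extend f)) p = V (bdryPt p) - V' (bdryPt p)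
  rw [extA]
  split_ifs with hp
  · exact h.xray_eq hf hp
  · have hp' := (mem_inflow_or_scat p).resolve_left hp
    rw [h.xray_eq hf hp', h.bdry p, h.bdry (scat p), scat_scat]
    ring

theorem signedRay_eq (h : TransportPair a V V') (hf : ∀ z ∈ disc, extend f z = a z)
    {q : ℂ × Circ} (hq : q.1 ∈ disc) : signedRay f q = (1 / 2) * (V q - V' q) := by
  have hp := entry_mem_inflow hq
  have ht := backTime_mem hq
  have h1 := signedRay_flow f hp ht
  have h2 := h.add_flow (entry q) (backTime q)
  rw [h.integral_eq hf ht, h.xray_eq hf hp, flow_zero, flow_entry hq] at h1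
  rw [flow_entry hq] at h2
  rw [h1]
  linear_combination (1 / 2 : ℂ) * h2

/-- H₋ multiplies V by -i and V' by i, so V - V' becomes -i(V + V'); this is S-invariant, so the
symmetrization doubles it. -/
theorem halfInverse_eq (h : TransportPair a V V') (hf : ∀ z ∈ disc, extend f z = a z) :
    halfInverse (oddDataLp f) =ᵐ[measBdry]
      fun p => (1 / (4 * π * Complex.I)) * (V (bdryPt p) + V' (bdryPt p)) := by
  obtain ⟨hm, hV⟩ := trigSpace_bdry h.pos
  obtain ⟨hm', hV'⟩ := trigSpace_bdry h.neg
  have e1 : oddDataLp f = hm.toLp _ - hm'.toLp _ := by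
    refine Lp.ext ?_
    filter_upwards [coeFn_oddDataLp f, Lp.coeFn_sub (hm.toLp (V ∘ bdryPt))
      (hm'.toLp (V' ∘ bdryPt)), hm.coeFn_toLp, hm'.coeFn_toLp] with p h1 h2 h3 h4
    rw [h1, h2, Pi.sub_apply, h3, h4, h.oddData_eq hf]
    rfl
  have e2 : hilbertLp volume {k | Odd k} (oddDataLp f) =
      -Complex.I • (hm.toLp _ + hm'.toLp _) := by
    rw [e1, map_sub, hilbertLp_of_pos (K := {k | Odd k}) (L := oddPos) (fun k hk => hk) hV,
      hilbertLp_of_neg (K := {k | Odd k}) (L := oddNeg) (fun k hk => hk) hV', smul_add, neg_smul, neg_smul,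
      sub_eq_add_neg]
  have e3 : scatLp (hm.toLp _ + hm'.toLp _) = hm.toLp _ + hm'.toLp _ := by
    refine Lp.ext ?_
    have h1 := Lp.coeFn_add (hm.toLp (V ∘ bdryPt)) (hm'.toLp (V' ∘ bdryPt))
    filter_upwards [coeFn_scatLp (hm.toLp (V ∘ bdryPt) + hm'.toLp (V' ∘ bdryPt)), h1,
      measurePreserving_scat.quasiMeasurePreserving.ae h1, hm.coeFn_toLp, hm'.coeFn_toLp,
      measurePreserving_scat.quasiMeasurePreserving.ae hm.coeFn_toLp,
      measurePreserving_scat.quasiMeasurePreserving.ae hm'.coeFn_toLp] with p h2 h3 h4 h5 h6 h7 h8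
    rw [h2, h3, h4, Pi.add_apply, Pi.add_apply, h5, h6, h7, h8]
    simp only [Function.comp]
    rw [h.bdry p, h.bdry (scat p), scat_scat, add_comm]
  have e4 : halfInverse (oddDataLp f) =
      (1 / (4 * π * Complex.I)) • (hm.toLp _ + hm'.toLp _) := by
    simp only [halfInverse, smul_apply, ContinuousLinearMap.comp_apply, add_apply,
      ContinuousLinearMap.id_apply]
    rw [e2, map_smul, e3, ← two_smul ℂ, smul_smul, smul_smul]
    congr 1
    have : (π : ℂ) ≠ 0 := by exact_mod_cast Real.pi_ne_zero
    field_simp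
    linear_combination (-8 : ℂ) * Complex.I_sq
  rw [e4]
  filter_upwards [Lp.coeFn_smul (1 / (4 * π * Complex.I) : ℂ)
    (hm.toLp (V ∘ bdryPt) + hm'.toLp (V' ∘ bdryPt)),
    Lp.coeFn_add (hm.toLp (V ∘ bdryPt)) (hm'.toLp (V' ∘ bdryPt)), hm.coeFn_toLp, hm'.coeFn_toLp]
    with p h1 h2 h3 h4
  rw [h1, Pi.smul_apply, h2, Pi.add_apply, h3, h4]
  rfl

theorem invariantLp_eq (h : TransportPair a V V') (hf : ∀ z ∈ disc, extend f z = a z)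
    (hm : MemLp V 2 ((volume.restrict disc).prod (volume : Measure Circ)))
    (hm' : MemLp V' 2 ((volume.restrict disc).prod (volume : Measure Circ))) :
    invariantLp f = (1 / (4 * π * Complex.I)) • (hm.toLp V + hm'.toLp V') := by
  refine Lp.ext ?_
  filter_upwards [coeFn_invExtLp (halfInverse (oddDataLp f)),
    invExt_congr (h.halfInverse_eq hf), ae_mem_disc,
    Lp.coeFn_smul (1 / (4 * π * Complex.I) : ℂ) (hm.toLp V + hm'.toLp V'),
    Lp.coeFn_add (hm.toLp V) (hm'.toLp V'), hm.coeFn_toLp, hm'.coeFn_toLp]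
    with q h1 h2 hq h3 h4 h5 h6
  have h7 := h.add_flow (entry q) (backTime q)
  rw [flow_entry hq] at h7
  rw [h3, Pi.smul_apply, h4, Pi.add_apply, h5, h6, h7]
  exact h1.trans h2

theorem hilbertInvariantLp_eq (h : TransportPair a V V') (hf : ∀ z ∈ disc, extend f z = a z)
    (hm : MemLp V 2 ((volume.restrict disc).prod (volume : Measure Circ)))
    (hm' : MemLp V' 2 ((volume.restrict disc).prod (volume : Measure Circ)))
    (hV : hm.toLp V ∈ harmonicSpace (volume.restrict disc) oddPos)
    (hV' : hm'.toLp V' ∈ harmonicSpace (volume.restrict disc) oddNeg) :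
    hilbertInvariantLp f = (-(1 / (4 * π)) : ℂ) • (hm.toLp V - hm'.toLp V') := by
  rw [hilbertInvariantLp, ContinuousLinearMap.comp_apply, h.invariantLp_eq hf hm hm', map_smul,
    map_add, hilbertLp_of_pos (L := oddPos) (fun k hk => ⟨mem_univ _, hk.2⟩) hV,
    hilbertLp_of_neg (L := oddNeg) (fun k hk => ⟨mem_univ _, hk.2⟩) hV', neg_smul,
    neg_add_eq_sub, ← smul_sub, smul_smul, ← neg_sub (hm.toLp V), smul_neg, ← neg_smul]
  congr 1
  have : (π : ℂ) ≠ 0 := by exact_mod_cast Real.pi_ne_zero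
  have hI := Complex.I_ne_zero
  field_simp

/-- Id + iH doubles positive frequencies and kills negative ones, so only V survives. -/
theorem solutionLp_eq (h : TransportPair a V V') (hf : ∀ z ∈ disc, extend f z = a z)
    (hm : MemLp V 2 ((volume.restrict disc).prod (volume : Measure Circ)))
    (hm' : MemLp V' 2 ((volume.restrict disc).prod (volume : Measure Circ)))
    (hV : hm.toLp V ∈ harmonicSpace (volume.restrict disc) oddPos)
    (hV' : hm'.toLp V' ∈ harmonicSpace (volume.restrict disc) oddNeg) :
    solutionLp f = hm.toLp V := by
  have hp : (π : ℂ) ≠ 0 := by exact_mod_cast Real.pi_ne_zero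
  have hI := Complex.I_ne_zero
  have e1 : (1 / (4 * π * Complex.I) : ℂ) = -Complex.I * (1 / (4 * π)) := by
    field_simp
    linear_combination Complex.I_sq
  have e2 : (2 * π * Complex.I) * (-Complex.I * (1 / (4 * π))) = (1 / 2 : ℂ) := by
    field_simp
    linear_combination (-4 : ℂ) * Complex.I_sq
  simp only [solutionLp, smul_apply, add_apply]
  rw [h.invariantLp_eq hf hm hm', h.hilbertInvariantLp_eq hf hm hm' hV hV', smul_smul,
    mul_neg, ← neg_mul, e1, ← smul_add, smul_smul, e2, add_add_sub_cancel, ← two_smul ℂ,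
    smul_smul]
  norm_num

end TransportPair

/-! ### Density of polynomials -/

/-- Stone–Weierstrass: the star algebra generated by the coordinate z is dense, and it is spanned by
the products z^j z̄^l. -/
theorem eq_top_of_monomials (S : Submodule ℂ C(disc, ℂ)) (hS : IsClosed (S : Set C(disc, ℂ)))
    (h : ∀ j l : ℕ, ∀ f : C(disc, ℂ), (∀ z : disc, f z = (z : ℂ) ^ j * conj (z : ℂ) ^ l) → f ∈ S) :
    S = ⊤ := by
  have h1 := ContinuousMap.elemental_id_eq_top (𝕜 := ℂ) disc
  rw [eq_top_iff]
  intro f _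
  have h2 : f ∈ StarAlgebra.elemental ℂ (ContinuousMap.restrict disc (.id ℂ)) := by
    rw [h1]; trivial
  have h3 : ((StarAlgebra.adjoin ℂ {ContinuousMap.restrict disc (.id ℂ)} :
      StarSubalgebra ℂ C(disc, ℂ)) : Set C(disc, ℂ)) ⊆ S := by
    intro g hg
    have hg' : g ∈ Subalgebra.toSubmodule (Algebra.adjoin ℂ
        ({ContinuousMap.restrict disc (.id ℂ)} ∪ star {ContinuousMap.restrict disc (.id ℂ)})) := hg
    rw [Algebra.adjoin_eq_span, star_singleton, singleton_union] at hg'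
    refine Submodule.span_le.mpr ?_ hg'
    intro m hm
    obtain ⟨j, l, rfl⟩ := (Submonoid.mem_closure_pair _ _ _).mp hm
    exact h j l _ fun z => rfl
  exact hS.closure_subset_iff.mpr h3 h2

theorem eq_top_of_transportPair (S : Submodule ℂ C(disc, ℂ)) (hS : IsClosed (S : Set C(disc, ℂ)))
    (h : ∀ f a V V', Continuous a → (∀ z ∈ disc, extend f z = a z) → TransportPair a V V' → f ∈ S) :
    S = ⊤ := by
  refine eq_top_of_monomials S hS fun j l f hf => ?_
  obtain ⟨V, V', hV⟩ := monomial_mem_pairSpace l j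
  refine h f _ V V' ?_ (fun z hz => ?_) hV
  · exact (continuous_id.pow j).mul (Complex.continuous_conj.pow l)
  · rw [extend_of_mem f hz, hf]

/-- For a transport pair both sides are (V - V')/2, and both are continuous in f. This replaces
Hn_ψ, known only as an L² class, by a function with explicit values along every geodesic. -/
theorem hilbertInvariantLp_eq_signedRayLp (f : C(disc, ℂ)) :
    (-(2 * π) : ℂ) • hilbertInvariantLp f = signedRayLp f := by
  have := eq_top_of_transportPair ((-(2 * π) : ℂ) • hilbertInvariantLp - signedRayLp).ker
    (ContinuousLinearMap.isClosed_ker _) fun f a V V' _ hf h => by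
      obtain ⟨hm, hV⟩ := trigSpace_SM h.pos
      obtain ⟨hm', hV'⟩ := trigSpace_SM h.neg
      have hp : (π : ℂ) ≠ 0 := by exact_mod_cast Real.pi_ne_zero
      show (-(2 * π) : ℂ) • hilbertInvariantLp f - signedRayLp f = 0
      rw [h.hilbertInvariantLp_eq hf hm hm' hV hV', smul_smul,
        show (-(2 * π) * -(1 / (4 * π)) : ℂ) = 1 / 2 by field_simp; norm_num, sub_eq_zero]
      refine Lp.ext ?_
      filter_upwards [Lp.coeFn_smul (1 / 2 : ℂ) (hm.toLp V - hm'.toLp V'),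
        Lp.coeFn_sub (hm.toLp V) (hm'.toLp V'), hm.coeFn_toLp, hm'.coeFn_toLp, ae_mem_disc,
        coeFn_signedRayLp f]
        with q h1 h2 h3 h4 hq h5
      rw [h1, Pi.smul_apply, h2, Pi.sub_apply, h3, h4, smul_eq_mul, ← h.signedRay_eq hf hq]
      exact h5.symm
  have h1 : f ∈ ((-(2 * π) : ℂ) • hilbertInvariantLp - signedRayLp).ker := by
    rw [this]; trivial
  exact sub_eq_zero.mp h1

theorem solutionLp_mem (f : C(disc, ℂ)) :
    solutionLp f ∈ harmonicSpace (volume.restrict disc) oddPos := by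
  have := eq_top_of_transportPair
    ((harmonicSpace (volume.restrict disc) oddPos).comap solutionLp.toLinearMap)
    ((Submodule.isClosed_topologicalClosure _).preimage solutionLp.continuous)
    fun f a V V' _ hf h => by
      obtain ⟨hm, hV⟩ := trigSpace_SM h.pos
      obtain ⟨hm', hV'⟩ := trigSpace_SM h.neg
      show solutionLp f ∈ harmonicSpace (volume.restrict disc) oddPos
      rw [h.solutionLp_eq hf hm hm' hV hV']
      exact hV
  have h1 : f ∈ (harmonicSpace (volume.restrict disc) oddPos).comap solutionLp.toLinearMap := by
    rw [this]; trivial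
  exact h1

/-! ### The transport equation in the sense of distributions -/

/-- The covering `(x, θ) ↦ (x, θ mod 2π)` of `SM`. -/
noncomputable def unroll (p : ℂ × ℝ) : ℂ × Circ := (p.1, (p.2 : Circ))

/-- The fundamental domain of `unroll`. -/
noncomputable def fundDomain : Set (ℂ × ℝ) := disc ×ˢ Ioc (0 : ℝ) (2 * π)

theorem volume_restrict_fundDomain : (volume : Measure (ℂ × ℝ)).restrict fundDomain =
    (volume.restrict disc).prod (volume.restrict (Ioc (0 : ℝ) (2 * π))) := by
  rw [fundDomain, Measure.volume_eq_prod, Measure.prod_restrict]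

theorem measurePreserving_unroll : MeasurePreserving unroll
    ((volume : Measure (ℂ × ℝ)).restrict fundDomain)
    ((volume.restrict disc).prod (volume : Measure Circ)) := by
  rw [volume_restrict_fundDomain]
  have h := AddCircle.measurePreserving_mk (2 * π) 0
  rw [zero_add] at h
  exact (MeasurePreserving.id _).prod h

/-- Makes both sides of the weak transport equation continuous functionals on L²(SM), computable
with any representative. -/
theorem exists_pairing {ψ : ℂ × ℝ → ℂ}
    (hψ : MemLp ψ 2 ((volume : Measure (ℂ × ℝ)).restrict fundDomain)) :
    ∃ T : L2 (volume.restrict disc) →L[ℂ] ℂ, ∀ (u : L2 (volume.restrict disc))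
      (v : ℂ × Circ → ℂ), v =ᵐ[measSM] u → T u = ∫ p in fundDomain, v (unroll p) * ψ p := by
  refine ⟨(innerSL ℂ (hψ.star.toLp (star ψ))).comp (Lp.compMeasurePreservingₗᵢ ℂ unroll
    measurePreserving_unroll).toContinuousLinearMap, fun u v huv => ?_⟩
  show inner ℂ (hψ.star.toLp (star ψ)) (Lp.compMeasurePreserving unroll
    measurePreserving_unroll u) = _
  rw [MeasureTheory.L2.inner_def]
  refine integral_congr_ae ?_
  filter_upwards [hψ.star.coeFn_toLp, Lp.coeFn_compMeasurePreserving u measurePreserving_unroll,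
    measurePreserving_unroll.quasiMeasurePreserving.ae huv] with p h1 h2 h3
  rw [h1, h2, Function.comp, h3]
  simp [RCLike.inner_apply]

theorem isFiniteMeasure_fundDomain :
    IsFiniteMeasure ((volume : Measure (ℂ × ℝ)).restrict fundDomain) := by
  rw [volume_restrict_fundDomain]
  infer_instance

theorem fundDomain_subset : fundDomain ⊆ Metric.closedBall (0 : ℂ) 1 ×ˢ Icc (0 : ℝ) (2 * π) :=
  prod_mono le_rfl Ioc_subset_Icc_self

theorem measurableSet_fundDomain : MeasurableSet fundDomain := measurable_disc.prod measurableSet_Ioc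

theorem isCompact_closure_fundDomain :
    IsCompact (Metric.closedBall (0 : ℂ) 1 ×ˢ Icc (0 : ℝ) (2 * π)) :=
  (isCompact_closedBall _ _).prod isCompact_Icc

theorem memLp_fundDomain {ψ : ℂ × ℝ → ℂ} (hψ : Continuous ψ) :
    MemLp ψ 2 ((volume : Measure (ℂ × ℝ)).restrict fundDomain) := by
  have := isFiniteMeasure_fundDomain
  obtain ⟨C, hC⟩ := isCompact_closure_fundDomain.exists_bound_of_continuousOn hψ.continuousOn
  refine MemLp.of_bound hψ.aestronglyMeasurable C ?_
  filter_upwards [ae_restrict_mem measurableSet_fundDomain] with p hp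
  exact hC p (fundDomain_subset hp)

namespace IsTest

variable {φ : ℂ × ℝ → ℂ}

theorem eq_zero (h : IsTest φ) {x : ℂ} (hx : x ∉ disc) (θ : ℝ) : φ (x, θ) = 0 := by
  obtain ⟨r, hr, hs⟩ := h.support
  refine hs x θ (hr.trans ?_)
  simpa [disc] using hx

theorem geodX_eq_zero (h : IsTest φ) {x : ℂ} (hx : x ∉ disc) (θ : ℝ) : geodX φ (x, θ) = 0 := by
  have hop : IsOpen {p : ℂ × ℝ | p.1 ∉ disc} :=
    (Metric.isClosed_closedBall.isOpen_compl).preimage continuous_fst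
  have : φ =ᶠ[nhds (x, θ)] fun _ => 0 := by
    filter_upwards [hop.mem_nhds hx] with p hp
    exact h.eq_zero hp p.2
  rw [geodX, this.fderiv_eq]
  simp

theorem continuous_geodX (h : IsTest φ) : Continuous (geodX φ) := by
  have h1 : Continuous (fderiv ℝ φ) := h.smooth.continuous_fderiv (by simp)
  unfold geodX
  exact h1.clm_apply (by fun_prop)

theorem hasLineDerivAt (h : IsTest φ) (x : ℂ) (θ : ℝ) :
    HasLineDerivAt ℝ (fun z => φ (z, θ)) (geodX φ (x, θ)) x (dir (θ : Circ)) := by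
  have h1 : HasFDerivAt φ (fderiv ℝ φ (x, θ)) (x, θ) :=
    (h.smooth.differentiable (by simp) _).hasFDerivAt
  have h2 : HasDerivAt (fun t : ℝ => (x + t • dir (θ : Circ), θ)) (dir (θ : Circ), (0 : ℝ)) 0 := by
    have h3 : HasDerivAt (fun t : ℝ => x + t • dir (θ : Circ)) (dir (θ : Circ)) 0 := by
      simpa using ((hasDerivAt_id (0 : ℝ)).smul_const (dir (θ : Circ))).const_add x
    exact h3.prodMk (hasDerivAt_const _ _)
  have h4 := HasFDerivAt.comp_hasDerivAt_of_eq (0 : ℝ) h1 h2 (by simp)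
  rw [dir_coe] at h4 ⊢
  exact h4

end IsTest

/-- For fixed θ this is integration by parts over the plane in the constant direction e^{iθ}; the
test function vanishes off the disc, so no boundary term appears. -/
theorem setIntegral_disc_parts {φ : ℂ × ℝ → ℂ} (hφ : IsTest φ) {V : ℂ × Circ → ℂ} {a : ℂ → ℂ}
    (hV : Continuous V) (ha : Continuous a) (hd : HasGeodDeriv V fun q => -a q.1) (θ : ℝ) :
    ∫ z in disc, V (z, (θ : Circ)) * geodX φ (z, θ) = ∫ z in disc, a z * φ (z, θ) := by
  have hφc : Continuous fun z => φ (z, θ) := hφ.smooth.continuous.comp (by fun_prop)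
  have hXc : Continuous fun z => geodX φ (z, θ) := hφ.continuous_geodX.comp (by fun_prop)
  have hVc : Continuous fun z => V (z, (θ : Circ)) := hV.comp (by fun_prop)
  have hcs : ∀ {g h : ℂ → ℂ}, Continuous g → Continuous h → (∀ z, z ∉ disc → h z = 0) →
      Integrable (fun z => g z * h z) := fun {g h} hg hh hz =>
    (hg.mul hh).integrable_of_hasCompactSupport
      (HasCompactSupport.intro (isCompact_closedBall (0 : ℂ) 1) fun z hz' => by
        simp [hz z hz'])
  have h1 := integral_bilinear_hasLineDerivAt_right_eq_neg_left_of_integrable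
    (μ := (volume : Measure ℂ)) (B := ContinuousLinearMap.mul ℝ ℂ)
    (f := fun z => V (z, (θ : Circ))) (f' := fun z => -a z) (g := fun z => φ (z, θ))
    (g' := fun z => geodX φ (z, θ)) (v := dir (θ : Circ))
    (hcs ha.neg hφc fun z hz => hφ.eq_zero hz θ)
    (hcs hVc hXc fun z hz => hφ.geodX_eq_zero hz θ)
    (hcs hVc hφc fun z hz => hφ.eq_zero hz θ)
    (fun z _ => hd z θ) (fun z _ => hφ.hasLineDerivAt z θ)
  simp only [ContinuousLinearMap.mul_apply', neg_mul, integral_neg, neg_neg] at h1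
  rwa [setIntegral_eq_integral_of_forall_compl_eq_zero fun z hz => by
    rw [hφ.geodX_eq_zero hz, mul_zero], setIntegral_eq_integral_of_forall_compl_eq_zero
    fun z hz => by rw [hφ.eq_zero hz, mul_zero]]

theorem setIntegral_fundDomain {G : ℂ × ℝ → ℂ} (hG : Continuous G) :
    ∫ p in fundDomain, G p = ∫ θ in Ioc (0 : ℝ) (2 * π), ∫ z in disc, G (z, θ) := by
  have hi : Integrable G ((volume : Measure (ℂ × ℝ)).restrict fundDomain) :=
    (hG.continuousOn.integrableOn_compact isCompact_closure_fundDomain).mono_set fundDomain_subset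
  rw [volume_restrict_fundDomain] at hi ⊢
  exact integral_prod_symm _ hi

theorem solvesTransport_solutionLp (f : C(disc, ℂ)) {w : ℂ × Circ → ℂ}
    (hw : w =ᵐ[measSM] solutionLp f) {φ : ℂ × ℝ → ℂ} (hφ : IsTest φ) :
    ∫ p in fundDomain, w (unroll p) * geodX φ p = ∫ p in fundDomain, extend f p.1 * φ p := by
  obtain ⟨T, hT⟩ := exists_pairing (memLp_fundDomain hφ.continuous_geodX)
  obtain ⟨T', hT'⟩ := exists_pairing (memLp_fundDomain hφ.smooth.continuous)
  have key : (T.comp solutionLp - T'.comp pullbackLp).ker = ⊤ := by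
    refine eq_top_of_transportPair _ (ContinuousLinearMap.isClosed_ker _)
      fun g a V V' ha hg h => ?_
    obtain ⟨hm, hV⟩ := trigSpace_SM h.pos
    obtain ⟨hm', hV'⟩ := trigSpace_SM h.neg
    have hVc := continuous_of_mem_trigSpace h.pos
    have hmk : Continuous fun x : ℝ => (x : Circ) := AddCircle.continuous_mk' _
    have hu : Continuous unroll := continuous_fst.prodMk (hmk.comp continuous_snd)
    show T (solutionLp g) - T' (pullbackLp g) = 0
    rw [h.solutionLp_eq hg hm hm' hV hV', hT _ V hm.coeFn_toLp.symm,
      hT' _ _ (coeFn_pullbackLp g).symm, sub_eq_zero,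
      setIntegral_fundDomain (G := fun p => V (unroll p) * geodX φ p)
        ((hVc.comp hu).mul hφ.continuous_geodX),
      setIntegral_fundDomain (G := fun p => extend g (unroll p).1 * φ p)
        ((((continuous_extend g).comp continuous_fst).comp hu).mul
        hφ.smooth.continuous)]
    refine integral_congr_ae (Filter.Eventually.of_forall fun θ => ?_)
    refine (setIntegral_disc_parts hφ hVc ha h.deriv θ).trans ?_
    exact setIntegral_congr_fun measurable_disc fun z hz => by
      simp only [unroll, hg z hz]
  have h1 : f ∈ (T.comp solutionLp - T'.comp pullbackLp).ker := by rw [key]; trivial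
  have h2 : T (solutionLp f) - T' (pullbackLp f) = 0 := h1
  rw [← hT _ w hw, sub_eq_zero.mp h2, hT' _ _ (coeFn_pullbackLp f).symm]
  rfl

/-! ### The solution for continuous data -/

theorem xray_congr {a b : ℂ → ℂ} (h : ∀ z ∈ disc, a z = b z) {p : Circ × Circ} (hp : p ∈ inflow) :
    xray a p = xray b p := by
  have hp' : 0 ≤ ccos p.2 := hp
  refine intervalIntegral.integral_congr fun t ht => ?_
  rw [uIcc_of_le (by positivity)] at ht
  exact h _ (flow_mem_disc ht)

theorem extA_xray_congr {a b : ℂ → ℂ} (h : ∀ z ∈ disc, a z = b z) (ε : ℂ) :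
    extA ε (xray a) = extA ε (xray b) := by
  funext p
  rw [extA, extA]
  split_ifs with hp
  · exact xray_congr h hp
  · rw [xray_congr h ((mem_inflow_or_scat p).resolve_left hp)]

/-- The representative `G` of H₋A₋I₀a is fixed, so that the formula for n holds at every point; the
second part identifies the class of n. -/
theorem coe_ae_halfInverse {n : Circ × Circ → ℂ} {f : C(disc, ℂ)} {a : ℂ → ℂ}
    (hfa : ∀ z ∈ disc, a z = extend f z)
    (hn : n = fun p => -(1 / (8 * π) : ℂ) * adjPminus (xray a) p) :
    (∃ G ∈ harmonicSpace (volume : Measure Circ) {k | Odd k},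
      ∀ p, n p = (1 / (8 * π) : ℂ) * (G p + G (scat p))) ∧
    n =ᵐ[measBdry] halfInverse (oddDataLp f) := by
  have hu : extA (-1) (xray a) = oddData f := extA_xray_congr hfa _
  have hm : MemLp (oddData f) 2 ((volume : Measure Circ).prod (volume : Measure Circ)) :=
    MemLp.of_bound (measurable_oddData f).aestronglyMeasurable _
      (Filter.Eventually.of_forall (norm_oddData_le f))
  have hG : hilbertOddBdry (oddData f) = hilbertLp volume {k | Odd k} (oddDataLp f) :=
    hilbertOn_of_memLp _ hm
  have hn' : ∀ p, n p = (1 / (8 * π) : ℂ) * (hilbertLp volume {k | Odd k} (oddDataLp f) p +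
      hilbertLp volume {k | Odd k} (oddDataLp f) (scat p)) := fun p => by
    rw [hn, ← hG]
    simp only [adjPminus, adjA, hu]
    ring
  refine ⟨⟨_, hilbertLp_mem _ (oddDataLp f), hn'⟩, ?_⟩
  set G := hilbertLp volume {k | Odd k} (oddDataLp f) with hGdef
  have h1 : halfInverse (oddDataLp f) = (1 / (8 * π) : ℂ) • (G + scatLp G) := rfl
  rw [h1]
  filter_upwards [Lp.coeFn_smul (1 / (8 * π) : ℂ) (G + scatLp G), Lp.coeFn_add G (scatLp G),
    coeFn_scatLp G] with p h2 h3 h4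
  rw [h2, Pi.smul_apply, h3, Pi.add_apply, h4, hn' p]
  rfl

/-- The two scattering relations differ by the shift of α by π, under which `G` is odd, and S ∘ S_A
is that shift itself. -/
theorem ae_scatA_eq_neg {G : L2 (volume : Measure Circ)}
    (hG : G ∈ harmonicSpace (volume : Measure Circ) {k | Odd k}) :
    ∀ᵐ p ∂measBdry, G (scatA p) + G (scat (scatA p)) = -(G p + G (scat p)) := by
  have h1 : ∀ᵐ p ∂measBdry, G (p.1, p.2 + piC) = -G p :=
    ae_odd_of_mem_harmonicSpace (fun k hk => hk) hG
  filter_upwards [h1, measurePreserving_scatA.quasiMeasurePreserving.ae h1] with p h2 h3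
  have e1 : ((scatA p).1, (scatA p).2 + piC) = scat p := by
    refine Prod.ext rfl ?_
    simp only [scatA, scat]
    abel
  have e2 : scat (scatA p) = (p.1, p.2 + piC) := by
    refine Prod.ext ?_ ?_
    · simp only [scatA, scat, two_smul]
      calc p.1 + piC + (p.2 + p.2) + piC + (-p.2 + -p.2) = p.1 + (piC + piC) := by abel
        _ = p.1 := by rw [piC_add_piC, add_zero]
    · simp only [scatA, scat]
      abel
  rw [e1] at h3
  rw [e2, h2, h3]
  ring

end DiscTransport

/-! ### The proposition for continuous data -/

open DiscTransport
theorem proposition4p4 (a : ℂ → ℂ) (ha : ContinuousOn a disc)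
    (n : Circ × Circ → ℂ) (hn : n = fun p => -(1 / (8 * π) : ℂ) * adjPminus (xray a) p)
    (w : ℂ × Circ → ℂ)
    (hw : w = fun q => 2 * π * Complex.I * (invExt n q + Complex.I * hilbertSM (invExt n) q)) :
    -- `n ∈ 𝒱₋`
    (MemLp n 2 measInflow ∧ ∀ᵐ p ∂measInflow, n (scatA p) = -n p) ∧
    -- all terms of `w` are square integrable
    MemLp (invExt n) 2 measSM ∧ MemLp w 2 measSM ∧
    FiberwiseOdd w ∧
    FiberwiseHolomorphic w ∧
    SolvesTransport w (fun q => -a q.1) ∧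
    HasInflowTrace w (fun p => (1 / 2) * xray a p - (Complex.I / 4) * adjPminus (xray a) p) ∧
    HasBdryTrace w (fun p => (1 / 2) * extA (-1) (xray a) p
      - (Complex.I / 4) * extA 1 (adjPminus (xray a)) p) := by
  -- The values of a off the disc are uncontrolled; they are replaced by those of a continuous
  -- extension, which leaves the integrals over geodesics in the disc unchanged.
  let f : C(disc, ℂ) := ⟨disc.domRestrict a, ha.domRestrict⟩
  have hfa : ∀ z ∈ disc, a z = extend f z := fun z hz => by rw [extend_of_mem f hz]; rfl
  obtain ⟨⟨G, hG, hnG⟩, hnB⟩ := coe_ae_halfInverse hfa hn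
  have hnL : MemLp n 2 measBdry := (memLp_congr_ae hnB).mpr (Lp.memLp (halfInverse (oddDataLp f)))
  have hψ : MemLp (invExt n) 2 measSM := memLp_invExt hnL
  have hψ' : MemLp (invExt n) 2 ((volume.restrict disc).prod (volume : Measure Circ)) := hψ
  have hN : invExt n =ᵐ[measSM] invariantLp f :=
    (invExt_congr hnB).trans (coeFn_invExtLp _).symm
  have hNLp : hψ'.toLp (invExt n) = invariantLp f :=
    Lp.ext (hψ'.coeFn_toLp.trans hN)
  have hH : hilbertSM (invExt n) = hilbertInvariantLp f := by
    rw [hilbertSM, hilbertOn_of_memLp _ hψ', hNLp]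
    rfl
  have hwS : w =ᵐ[measSM] solutionLp f := by
    have h0 : solutionLp f = (2 * π * Complex.I) •
      (invariantLp f + Complex.I • hilbertInvariantLp f) := rfl
    rw [h0]
    filter_upwards [hN, Lp.coeFn_smul (2 * π * Complex.I)
      (invariantLp f + Complex.I • hilbertInvariantLp f),
      Lp.coeFn_add (invariantLp f) (Complex.I • hilbertInvariantLp f),
      Lp.coeFn_smul Complex.I (hilbertInvariantLp f)] with q h1 h2 h3 h4
    rw [h2, Pi.smul_apply, h3, Pi.add_apply, h4, Pi.smul_apply, hw]
    simp only [h1, hH, smul_eq_mul]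
  -- The factor in front of Hn_ψ is 2πi · i = -2π, exactly the one for which the signed ray integral
  -- appears.
  have hwK : ∀ᵐ q ∂measSM, w q = 2 * π * Complex.I * invExt n q + signedRay f q := by
    have h0 := hilbertInvariantLp_eq_signedRayLp f
    have h1 := coeFn_signedRayLp f
    rw [← h0] at h1
    filter_upwards [h1, Lp.coeFn_smul (-(2 * π) : ℂ) (hilbertInvariantLp f)] with q h2 h3
    rw [h3, Pi.smul_apply, smul_eq_mul] at h2
    rw [hw, ← h2, hH]
    linear_combination (2 * π * hilbertInvariantLp f q) * Complex.I_sq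
  have hmem := solutionLp_mem f
  have hnP : ∀ p, adjPminus (xray a) p = -(8 * π) * n p := fun p => by
    have : (π : ℂ) ≠ 0 := by exact_mod_cast Real.pi_ne_zero
    rw [hn]
    field_simp
  -- Exact, not just almost everywhere: n is a symmetrization under the involution S.
  have hnS : ∀ p, n (scat p) = n p := fun p => by
    rw [hnG, hnG, scat_scat, add_comm]
  have trace : ∀ᵐ p ∂measInflow, ∃ c : ℝ → ℂ, ContinuousOn c (Icc 0 (2 * ccos p.2)) ∧
      (∀ᵐ t ∂(volume.restrict (Icc 0 (2 * ccos p.2))), w (flow p t) = c t) ∧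
      c 0 = 2 * π * Complex.I * n p + (1 / 2) * xray a p ∧
      c (2 * ccos p.2) = 2 * π * Complex.I * n p - (1 / 2) * xray a p := by
    filter_upwards [ae_flow_of_ae hwK, ae_restrict_mem measurableSet_inflow] with p h1 hp
    have hx := xray_congr hfa hp
    -- The continuous representative is a constant minus a primitive of the data along the geodesic.
    refine ⟨fun t => 2 * π * Complex.I * n p + ((1 / 2) * xray a p -
      ∫ s in (0 : ℝ)..t, extend f (flow p s).1), ?_, ?_, ?_, ?_⟩
    · refine Continuous.continuousOn ?_
      exact continuous_const.add (continuous_const.sub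
        (intervalIntegral.continuous_primitive
          (fun s t => intervalIntegrable_extend f (continuous_flow_fst p) s t) 0))
    · filter_upwards [h1, ae_restrict_mem measurableSet_Icc] with t h2 ht
      rw [h2, invExt_flow n p hp t ht, signedRay_flow f hp ht, hx]
    · simp
    · simp only []
      rw [show ∫ s in (0 : ℝ)..(2 * ccos p.2), extend f (flow p s).1 = xray a p from hx.symm]
      ring
  refine ⟨⟨hnL.restrict _, ?_⟩, hψ, ?_, ?_, ?_, ?_, ?_, ?_⟩
  · refine ae_restrict_of_ae ?_
    filter_upwards [ae_scatA_eq_neg hG] with p hp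
    rw [hnG, hnG, hp, mul_neg]
  · exact (memLp_congr_ae hwS).mpr (Lp.memLp (solutionLp f))
  · have h1 : ∀ᵐ q ∂measSM, w (q.1, q.2 + piC) = solutionLp f (q.1, q.2 + piC) :=
      (measurePreserving_fiberShift (ν := volume.restrict disc)).quasiMeasurePreserving.ae hwS
    have h2 : ∀ᵐ q ∂measSM, solutionLp f (q.1, q.2 + piC) = -solutionLp f q :=
      ae_odd_of_mem_harmonicSpace (fun k hk => hk.1) hmem
    filter_upwards [hwS, h1, h2] with q h3 h4 h5
    rw [h4, h5, h3]
  · intro k hk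
    have h1 : ∀ᵐ x ∂(volume.restrict disc), ∀ᵐ θ : Circ, w (x, θ) = solutionLp f (x, θ) :=
      Measure.ae_ae_of_ae_prod hwS
    filter_upwards [h1, ae_integral_fourier_eq_zero (k := k) (fun h => lt_asymm hk h.2) hmem]
      with x h2 h3
    rw [← h3]
    exact integral_congr_ae (h2.mono fun θ hθ => by simp only [hθ])
  · intro φ hφ
    have h1 := solvesTransport_solutionLp f hwS hφ
    refine h1.trans ?_
    rw [← integral_neg]
    refine setIntegral_congr_fun measurableSet_fundDomain fun p hp => ?_
    simp only [hfa p.1 hp.1]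
    ring
  · filter_upwards [trace] with p ⟨c, hc, hwc, h0, _⟩
    refine ⟨c, hc, hwc, ?_⟩
    rw [h0, hnP]
    ring
  · filter_upwards [trace, ae_restrict_mem measurableSet_inflow] with p ⟨c, hc, hwc, h0, h1⟩ hp
    refine ⟨c, hc, hwc, ?_, ?_⟩
    · rw [h0, extA, extA, if_pos hp, if_pos hp, hnP]
      ring
    · rw [h1, extA, extA]
      split_ifs with hs
      -- Both end points are inward only at glancing directions, where the geodesic is a single
      -- point and the X-ray transform vanishes, so the two prescriptions for the exit value agree.
      · have hz : ccos p.2 = 0 := by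
          have h2 : 0 ≤ (dir p.2).re := hp
          have h3 : 0 ≤ (dir (scat p).2).re := hs
          rw [dir_scat_snd, ← conj_dir] at h3
          simp only [Complex.neg_re, Complex.conj_re] at h3
          exact le_antisymm (by unfold ccos; linarith) h2
        have hz' : ccos (scat p).2 = 0 := by
          have : ccos (scat p).2 = -ccos p.2 := by
            rw [ccos, dir_scat_snd, ← conj_dir]
            simp [ccos]
          rw [this, hz, neg_zero]
        have hx : ∀ r : Circ × Circ, ccos r.2 = 0 → xray a r = 0 := fun r hr => by
          rw [xray, hr]; simp
        rw [hx p hz, hx _ hz', hnP, hnS]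
        ring
      · rw [scat_scat, hnP]
        ring
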